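/- Let $q\in[0,1]$ and let $\mu_\Lambda$ denote the product of Bernoulli$(1-q)$ laws on $\{0,1\}^\Lambda$, $\Lambda\subset\mathbb Z$ (state $0$ = empty, state $1$ = occupied). The one-dimensional East process $(\eta(s))_{s\ge0}$ is given by its graphical construction: each site $y\in\mathbb Z$ carries an independent rate-$1$ Poisson clock, and each ring an independent Bernoulli$(1-q)$ coin; a ring at $y$ is a legal update if $y+1$ is empty, in which case the state of $y$ is set to the coin, and otherwise nothing happens. The East process on $\{y: y<b\}$ (or on $\{a,\dots,b-1\}$) with empty boundary condition is defined in the same way, using only the clocks and coins of these sites and with $b$ regarded as always empty. If $\eta_x(0)=0$, the distinguished zero started at $x$ is the path $(\xi_s)_{s\ge0}$ defined by $t_0=0$, $t_{i+1}$ = the time of the first legal update at $x+i$ after $t_i$ (with $t_{i+1}=\infty$ if there is none), and $\xi_s=x+i$ for $s\in[t_i,t_{i+1})$. (1) Let $\omega\in\{0,1\}^{\mathbb Z}$ with $\omega_x=0$, let $\eta(0)=\omega$ and fix $t>0$. Almost surely there is $N\ge0$ with $0=t_0<t_1<\dots<t_N<t<t_{N+1}$, and $\xi_s=x+i$ for all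 $i\le N$ and $s\in[t_i,t_{i+1})\cap[0,t]$. Conditionally on the trajectory $(\xi_s)_{s\le t}$, the process $\big((\eta_y(s))_{y<\xi_s}\big)_{s\le t}$ to the left of the distinguished zero has the law of the following process: it starts from $(\omega_y)_{y<x}$; during $[t_i,t_{i+1})\cap[0,t]$, $0\le i\le N$, the sites $y<x+i$ evolve as the East process with empty boundary condition at $x+i$; and at each jump time $t_{i+1}$, $0\le i<N$, the vacated site $x+i$ joins with a state sampled from an independent Bernoulli$(1-q)$ variable. In particular, for every $a\le x$, the same holds with $\{y<x+i\}$ replaced by $\{a,\dots,x+i-1\}$. (2) Let $a\le x$, let $\psi^-$ and $\psi^+$ be probability measures on $\{0,1\}^{\{y<a\}}$ and $\{0,1\}^{\{y>x\}}$, and let $\eta(0)$ have law $\psi^-\otimes\mu_{\{a,\dots,x-1\}}\otimes\delta_0\otimes\psi^+$, where $\delta_0$ is at the site $x$ (and the factor $\mu_{\{a,\dots,x-1\}}$ is absent if $a=x$). Then, for every $t\ge0$, the conditional law of $(\eta_y(t))_{a\le y\le\xi_t-1}$ given the trajectory $(\xi_s)_{s\le t}$ is the equilibrium law $\mu_{\{a,\dots,\xi_t-1\}}$.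 -/

import Mathlib

open MeasureTheory ProbabilityTheory unitInterval

namespace East

noncomputable section

/-- Configurations on `ℤ`: `true` is an occupied site (state 1), `false` an empty site (state 0). -/
abbrev Config := ℤ → Bool

/-- The marks of the graphical construction: to the pair (site `y`, index `k`) are attached the
waiting time before the `k`-th ring (`k = 0, 1, …`) of the clock at `y`, counted from the previous
ring (from time 0 if `k = 0`), and the coin tossed at that ring. -/
abbrev Marks := ℤ × ℕ → ℝ × Bool

instance isProbabilityMeasure_exp_one : IsProbabilityMeasure (expMeasure 1) :=
  isProbabilityMeasure_expMeasure one_pos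

/-- Bernoulli(`1 - q`) law of a single site: empty with probability `q`, occupied with
probability `1 - q`. -/
def siteLaw (q : I) : Measure Bool := bernoulliMeasure false true q

instance isProbabilityMeasure_siteLaw (q : I) : IsProbabilityMeasure (siteLaw q) := by
  unfold siteLaw; infer_instance

/-- The equilibrium measure `μ_Λ`: the product of Bernoulli(`1 - q`) laws over the set `Λ`. -/
def equilibrium (q : I) (Λ : Set ℤ) : Measure (Λ → Bool) :=
  Measure.infinitePi fun _ => siteLaw q

/-- The equilibrium measure on all of `ℤ`. -/
def equilibriumZ (q : I) : Measure Config := Measure.infinitePi fun _ => siteLaw q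

/-- The law of the marks: independent rate 1 Poisson clocks (exponential waiting times) at the
sites of `ℤ`, and independent Bernoulli(`1 - q`) coins at the rings. -/
def marksLaw (q : I) : Measure Marks :=
  Measure.infinitePi fun _ => (expMeasure 1).prod (siteLaw q)

/-- The time of the `k`-th ring of the clock at `y`. -/
def ring (m : Marks) (y : ℤ) (k : ℕ) : ℝ := ∑ j ∈ Finset.range (k + 1), (m (y, j)).1

/-- The coin tossed at the `k`-th ring of the clock at `y`. -/
def coin (m : Marks) (y : ℤ) (k : ℕ) : Bool := (m (y, k)).2

open Classical in
/-- The state of a site with starting state `v`, when `L` is the set of indices of the legal rings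
that it has seen so far: the last coin tossed at a legal ring, and `v` if there was none. -/
def updated (v : Bool) (L : Set ℕ) (c : ℕ → Bool) : Bool :=
  if L.Nonempty then c (sSup L) else v

/-- State at time `s` of site `y` in the East process from `ω` in which site `y + n` is kept fixed
in its initial state: a ring at `y` is legal when the right neighbour `y + 1` is empty. (Almost
surely no two clocks ring simultaneously, so the neighbour has the same state just before the ring
and at the ring.) -/
def frozen (ω : Config) (m : Marks) : ℕ → ℤ → ℝ → Bool
  | 0, y, _ => ω y
  | n + 1, y, s =>
      updated (ω y) {k | ring m y k ≤ s ∧ frozen ω m n (y + 1) (ring m y k) = false} (coin m y)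

/-- The East process on `ℤ` started from `ω`, as produced by the graphical construction: the state
of site `y` at time `s`. Almost surely some site `y + n` has a clock that has not rung up to time
`s`; its state is still `ω (y + n)`, and the state of `y` at time `s` is a function of the rings and
coins between `y` and `y + n`. -/
def eta (ω : Config) (m : Marks) (s : ℝ) (y : ℤ) : Bool :=
  frozen ω m (sInf {n : ℕ | ∀ k, s < ring m (y + n) k}) y s

/-- The jump times of the distinguished zero started at `x`: `t_0 = 0`, and `t_{i+1}` is the time
of the first legal update at `x + i` after `t_i` (`⊤` if there is none). -/
def jumpTime (ω : Config) (m : Marks) (x : ℤ) : ℕ → EReal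
  | 0 => 0
  | i + 1 => ⨅ (k : ℕ) (_ : jumpTime ω m x i < (ring m (x + i) k : EReal) ∧
      eta ω m (ring m (x + i) k) (x + i + 1) = false), (ring m (x + i) k : EReal)

/-- The position `ξ_s` of the distinguished zero at time `s`. -/
def dz (ω : Config) (m : Marks) (x : ℤ) (s : ℝ) : ℤ :=
  x + (sSup {n : ℕ | jumpTime ω m x n ≤ (s : EReal)} : ℕ)

/-- The σ-algebra generated by the trajectory `(ξ_s)_{0 ≤ s ≤ t}` of a random path `ξ`. -/
@[reducible] def trajSigma {Ω : Type*} (ξ : Ω → ℝ → ℤ) (t : ℝ) : MeasurableSpace Ω :=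
  MeasurableSpace.comap (fun w (s : Set.Icc (0 : ℝ) t) => ξ w s) inferInstance

/-- The part on `[0, t]` and strictly to the left of the moving boundary `θ` of a
configuration-valued path `ζ`; the sites `y ≥ θ s` are assigned the dummy state `false`. -/
def leftPart (θ : ℝ → ℤ) (ζ : ℝ → Config) (t : ℝ) : Set.Icc (0 : ℝ) t → Config :=
  fun s y => if y < θ s then ζ s y else false

open Classical in
/-- Auxiliary recursion for `eastLeft`: the state of site `y` at time `s`, computed from the
`n - 1` sites to its right. The value is `false` at the sites `y ≥ θ s`: this is the empty boundary
condition at `θ s`. -/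
def eastLeftAux (θ : ℝ → ℤ) (ρ : Config) (m : Marks) : ℕ → ℤ → ℝ → Bool
  | 0, _, _ => false
  | n + 1, y, s =>
      if y < θ s then
        updated (ρ y)
          {k | ring m y k ≤ s ∧ y < θ (ring m y k) ∧
            eastLeftAux θ ρ m n (y + 1) (ring m y k) = false} (coin m y)
      else false

/-- The East process on the growing half-line `{y | y < θ s}` with empty boundary condition at
`θ s`, for a deterministic nondecreasing path `θ`. While `θ` stays at `b`, the sites `y < b` evolve
by the graphical construction from the marks `m`, the site `b` being empty: a ring at `y` is legal
when `y + 1` is empty, and `y + 1 = b` counts as empty. The sites `y < θ 0` start from `ρ y`; when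
`θ` moves on beyond a site `y ≥ θ 0`, this site joins the dynamics in the state `ρ y`. Since
dependence propagates only from right to left, the restriction to `{y | a ≤ y < θ s}` is, for each
`a`, the East process on this finite interval with empty boundary condition at `θ s`. -/
def eastLeft (θ : ℝ → ℤ) (ρ : Config) (m : Marks) (s : ℝ) : Config :=
  fun y => eastLeftAux θ ρ m (θ s - y).toNat y s

/-- The configuration equal to `ω` to the left of `x` and to `β` at `x` and to its right. -/
def joinAt (x : ℤ) (ω β : Config) : Config := fun y => if y < x then ω y else β y

/-- The configuration on `ℤ` given by `p.1` on `{y | y < a}`, by `p.2.1` on `{a, …, x - 1}`, empty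
at `x`, and given by `p.2.2` on `{y | x < y}`. -/
def glue (a x : ℤ) (p : (Set.Iio a → Bool) × (Set.Ico a x → Bool) × (Set.Ioi x → Bool)) : Config :=
  fun y =>
    if hl : y < a then p.1 ⟨y, hl⟩
    else if hr : x < y then p.2.2 ⟨y, hr⟩
    else if hm : y < x then p.2.1 ⟨y, not_lt.mp hl, hm⟩
    else false

/-- The initial law `ψ⁻ ⊗ μ_{a, …, x - 1} ⊗ δ_0 ⊗ ψ⁺`, with `δ_0` sitting at `x`. -/
def initialLaw (q : I) (a x : ℤ) (ψl : Measure (Set.Iio a → Bool))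
    (ψr : Measure (Set.Ioi x → Bool)) : Measure Config :=
  (ψl.prod ((equilibrium q (Set.Ico a x)).prod ψr)).map (glue a x)

end

end East

namespace East

/-! ### Product measures -/

/-! The trajectory of the distinguished zero consults only part of the randomness. At the site `x +
i` it uses the initial state, the waiting times of the rings up to the jump time `t_{i+1}` included,
and the coins tossed strictly before `t_{i+1}`. The coin of the jump itself, whatever the site does
later, and everything to the left of `x` never enter, because information travels only from right to
left. `AgreesBefore` records the consulted data and `AgreesBefore.jumpTime_eq` shows that they
determine the jump times.

For the law to the left of the zero, the unconsulted marks are replaced by independent copies. The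
exponential law is memoryless, so a clock may be continued after a time `T` by what an independent
clock does after `T` (`measurePreserving_after`), and the law of the marks is unchanged
(`measurePreserving_resampleSite`, `measurePreserving_resample`). The ring at which the zero jumps
has a random index; the space is cut according to this index, and each piece is stable under the
corresponding resampling (`measurePreserving_of_partition`). With the resampled marks, the process
to the left of the zero equals, path by path, the East process with empty boundary driven by fresh
marks (`eta_eq_eastLeft`): the site of the zero is empty (`eta_dz`), and the resampled coin of a
jump is the state in which the vacated site joins. This gives the joint law `measure_leftPart_eta`,
which `condExp_of_joint` turns into a conditional law once the candidate is known to be a function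
of the trajectory on `[0, t]` (`jumpPath_hitTime`).

The equilibrium statement is proved directly, revealing states from right to left starting at the
zero. The state of `y` at time `t` is the coin of the last legal ring at `y`, or the initial state
if there was none. Legality at `y` does not depend on the coins at `y`. If the zero started at or to
the left of `y` and has passed it, the last legal ring is not earlier than the jump away from `y`,
so its coin is unconsulted; if there was no legal ring, then `y < x` and the initial state is a
Bernoulli variable that the trajectory ignores. Either way a single Bernoulli variable can be
resampled without affecting the trajectory or the states to the right (`measure_rightEvent_inter`).
Multiplying over the sites gives `measure_interval`, and then `condExp_equilibrium`. -/

open Classical in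
/-- A configuration taken from `p.1` on `J` and, through the reindexing `f`, from `p.2` off `J`. -/
noncomputable def mix {ι κ X : Type*} (J : Set ι) (f : ι → κ) (p : (ι → X) × (κ → X)) : ι → X :=
  fun i => if i ∈ J then p.1 i else p.2 (f i)

theorem measurable_mix {ι κ X : Type*} [MeasurableSpace X] (J : Set ι) (f : ι → κ) :
    Measurable (mix (X := X) J f) := by
  classical
  refine measurable_pi_lambda _ fun i => ?_
  unfold mix
  split_ifs <;> fun_prop

/-- Independent product measures mix to a product measure. -/
theorem measurePreserving_mix {ι κ X : Type*} [MeasurableSpace X] (μ : Measure X)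
    [IsProbabilityMeasure μ] (J : Set ι) (f : ι → κ) (hf : Set.InjOn f Jᶜ) :
    MeasurePreserving (mix J f)
      ((Measure.infinitePi fun _ : ι => μ).prod (Measure.infinitePi fun _ : κ => μ))
      (Measure.infinitePi fun _ : ι => μ) := by
  classical
  refine ⟨measurable_mix J f, ?_⟩
  refine Measure.eq_infinitePi _ fun s t ht => ?_
  rw [Measure.map_apply (measurable_mix J f)
    (MeasurableSet.pi s.countable_toSet fun i _ => ht i)]
  rcases isEmpty_or_nonempty ι with h | h
  · have : s = ∅ := Finset.eq_empty_of_isEmpty s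
    subst this
    simp
  have hinj : Set.InjOn f (s.filter (· ∉ J) : Finset ι) := hf.mono fun i hi => by
    simpa using (Finset.mem_filter.1 hi).2
  -- `g` recovers which coordinate of `ι` a coordinate of `κ` feeds, so that the constraints `t` off
  -- `J` become a box in `κ → X`.
  set g : κ → ι := Function.invFunOn f (s.filter (· ∉ J) : Finset ι) with hg
  have hgf : ∀ i ∈ s, i ∉ J → g (f i) = i := fun i hi hJ =>
    hinj.leftInvOn_invFunOn (by simp [hi, hJ])
  have hpre : mix J f ⁻¹' (Set.pi s t) =
      (Set.pi ((s.filter (· ∈ J) : Finset ι) : Set ι) t) ×ˢ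
        (Set.pi (((s.filter (· ∉ J)).image f : Finset κ) : Set κ) fun k => t (g k)) := by
    ext p
    simp only [mix, Set.mem_preimage, Set.mem_pi, SetLike.mem_coe, Set.mem_prod,
      Finset.mem_filter, Finset.mem_image, forall_exists_index, and_imp]
    constructor
    · intro hp
      refine ⟨fun i hi hJ => by simpa [hJ] using hp i hi, ?_⟩
      rintro k i hi hJ rfl
      rw [hgf i hi hJ]
      simpa [hJ] using hp i hi
    · rintro ⟨h1, h2⟩ i hi
      by_cases hJ : i ∈ J
      · simpa [hJ] using h1 i hi hJ
      · have := h2 (f i) i hi hJ rfl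
        rw [hgf i hi hJ] at this
        simpa [hJ] using this
  rw [hpre, Measure.prod_prod, Measure.infinitePi_pi _ fun i _ => ht i,
    Measure.infinitePi_pi _ fun i _ => ht _, Finset.prod_image hinj,
    ← Finset.prod_filter_mul_prod_filter_not s (· ∈ J)]
  congr 1
  refine Finset.prod_congr rfl fun i hi => ?_
  rw [Finset.mem_filter] at hi
  rw [hgf i hi.1 hi.2]

/-- Reindexing a product measure. -/
theorem measurePreserving_reindex {ι κ X : Type*} [MeasurableSpace X] (μ : Measure X)
    [IsProbabilityMeasure μ] (f : ι → κ) (hf : Function.Injective f) :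
    MeasurePreserving (fun (m : κ → X) i => m (f i)) (Measure.infinitePi fun _ : κ => μ)
      (Measure.infinitePi fun _ : ι => μ) := by
  have h1 := measurePreserving_mix μ (∅ : Set ι) f hf.injOn
  have h2 : MeasurePreserving (Prod.snd : (ι → X) × (κ → X) → κ → X) _ _ :=
    measurePreserving_snd (μ := Measure.infinitePi fun _ : ι => μ)
      (ν := Measure.infinitePi fun _ : κ => μ)
  refine ⟨by fun_prop, ?_⟩
  rw [← h2.map_eq, Measure.map_map (by fun_prop) (by fun_prop)]
  refine Eq.trans ?_ h1.map_eq
  congr 1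
  ext p i
  simp [mix]

/-- Resampling one coordinate of a product measure. -/
theorem measurePreserving_update {ι X : Type*} [DecidableEq ι] [MeasurableSpace X] (μ : Measure X)
    [IsProbabilityMeasure μ] (i : ι) :
    MeasurePreserving (fun p : (ι → X) × X => Function.update p.1 i p.2)
      ((Measure.infinitePi fun _ : ι => μ).prod μ) (Measure.infinitePi fun _ : ι => μ) := by
  have h1 := measurePreserving_mix μ ({i}ᶜ : Set ι) (fun j : ι => j) (Function.injective_id.injOn)
  have h2 : MeasurePreserving (Prod.map id (fun m : ι → X => m i))
      ((Measure.infinitePi fun _ : ι => μ).prod (Measure.infinitePi fun _ : ι => μ))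
      ((Measure.infinitePi fun _ : ι => μ).prod μ) :=
    (MeasurePreserving.id _).prod (measurePreserving_eval_infinitePi (fun _ : ι => μ) i)
  have hm : Measurable (fun p : (ι → X) × X => Function.update p.1 i p.2) := by
    refine measurable_pi_lambda _ fun j => ?_
    by_cases h : j = i
    · subst h; simpa using measurable_snd
    · simp only [Function.update_of_ne h]; fun_prop
  refine ⟨hm, ?_⟩
  rw [← h2.map_eq, Measure.map_map hm h2.measurable]
  refine Eq.trans ?_ h1.map_eq
  congr 1
  ext p j
  by_cases h : j = i
  · subst h; simp [mix]
  · simp [mix, h]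

/-- If a set of positive measure is given, some coordinate along an injective sequence lies in it,
almost surely. -/
theorem ae_exists_coord_mem {ι X : Type*} [MeasurableSpace X] (μ : Measure X)
    [IsProbabilityMeasure μ] (f : ℕ → ι) (hf : Function.Injective f) {S : Set X}
    (hS : MeasurableSet S) (h0 : μ S ≠ 0) :
    ∀ᵐ m ∂(Measure.infinitePi fun _ : ι => μ), ∃ n, m (f n) ∈ S := by
  have h1 : ∀ᵐ u ∂(Measure.infinitePi fun _ : ℕ => μ), ∃ n, u n ∈ S := by
    rw [ae_iff]
    have hc : μ Sᶜ < 1 := by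
      rw [prob_compl_eq_one_sub hS]
      exact ENNReal.sub_lt_self ENNReal.one_ne_top one_ne_zero h0
    have hle : ∀ n : ℕ, (Measure.infinitePi fun _ : ℕ => μ) {u | ¬ ∃ n, u n ∈ S} ≤ μ Sᶜ ^ n := by
      intro n
      calc _ ≤ (Measure.infinitePi fun _ : ℕ => μ)
            (Set.pi ((Finset.range n : Finset ℕ) : Set ℕ) fun _ => Sᶜ) := by
            refine measure_mono fun u hu i _ => ?_
            simp only [Set.mem_ofPred_eq, not_exists] at hu
            exact hu i
        _ = _ := by
          rw [Measure.infinitePi_pi _ fun i _ => hS.compl]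
          simp
    exact le_antisymm (ge_of_tendsto' (ENNReal.tendsto_pow_atTop_nhds_zero_of_lt_one hc) hle)
      bot_le
  exact (measurePreserving_reindex μ f hf).quasiMeasurePreserving.ae h1

/-! ### The exponential law -/

theorem nullSingletonClass_exp : NullSingletonClass (expMeasure 1) := by
  refine ⟨fun a => ?_⟩
  exact withDensity_absolutelyContinuous _ _ (measure_singleton a)

theorem exp_Iic (x : ℝ) :
    expMeasure 1 (Set.Iic x) = ENNReal.ofReal (if 0 ≤ x then 1 - Real.exp (-x) else 0) := by
  have h := cdf_expMeasure_eq one_pos x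
  rw [ProbabilityTheory.cdf_eq_real, one_mul] at h
  rw [← ENNReal.ofReal_toReal (measure_ne_top (expMeasure 1) (Set.Iic x))]
  congr 1

theorem exp_Ioi (x : ℝ) (hx : 0 ≤ x) :
    expMeasure 1 (Set.Ioi x) = ENNReal.ofReal (Real.exp (-x)) := by
  rw [← Set.compl_Iic, prob_compl_eq_one_sub measurableSet_Iic, exp_Iic, if_pos hx,
    ← ENNReal.ofReal_one, ← ENNReal.ofReal_sub]
  · congr 1; ring
  · simpa using hx

theorem exp_Ici (x : ℝ) (hx : 0 ≤ x) :
    expMeasure 1 (Set.Ici x) = ENNReal.ofReal (Real.exp (-x)) := by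
  have := nullSingletonClass_exp
  rw [← exp_Ioi x hx, measure_congr Ioi_ae_eq_Ici.symm]

/-- The exponential law is memoryless. -/
theorem exp_memoryless (s : ℝ) (hs : 0 ≤ s) :
    ((expMeasure 1).restrict (Set.Ici s)).map (fun a => a - s) =
      expMeasure 1 (Set.Ici s) • expMeasure 1 := by
  have := nullSingletonClass_exp
  have hm : Measurable fun a : ℝ => a - s := by fun_prop
  refine Measure.ext_of_Iic _ _ fun a => ?_
  rw [Measure.map_apply hm measurableSet_Iic, Measure.restrict_apply (hm measurableSet_Iic),
    Measure.smul_apply, smul_eq_mul]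
  have h1 : (fun a : ℝ => a - s) ⁻¹' Set.Iic a ∩ Set.Ici s = Set.Iic (a + s) ∩ Set.Ici s := by
    ext b; simp
  rw [h1]
  rcases lt_or_ge a 0 with ha | ha
  · rw [exp_Iic, if_neg (not_le.2 ha)]
    have : Set.Iic (a + s) ∩ Set.Ici s = ∅ := by
      ext b; simp; intro h; linarith
    simp [this]
  · have h2 : Set.Iic (a + s) ∩ Set.Ici s = Set.Ici s \ Set.Ioi (a + s) := by
      ext b; simp [and_comm]
    rw [h2, measure_sdiff _ measurableSet_Ioi.nullMeasurableSet (measure_ne_top _ _), exp_Ici s hs,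
      exp_Ioi _ (by positivity), exp_Iic, if_pos ha, ← ENNReal.ofReal_mul (Real.exp_pos _).le,
      ← ENNReal.ofReal_sub _ (Real.exp_pos _).le]
    · congr 1
      rw [mul_sub, mul_one, ← Real.exp_add]
      ring_nf
    · intro b hb
      simp at hb ⊢
      linarith

theorem exp_pos : ∀ᵐ a ∂expMeasure 1, 0 < a := by
  rw [ae_iff]
  have : {a : ℝ | ¬ 0 < a} = Set.Iic 0 := by ext; simp
  rw [this, exp_Iic]
  simp


/-! ### Measurability of integer-valued functions -/

theorem measurable_nat_sInf {α : Type*} [MeasurableSpace α] {S : α → Set ℕ}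
    (hS : ∀ k, MeasurableSet {a | k ∈ S a}) : Measurable fun a => sInf (S a) := by
  refine measurable_to_countable' fun n => ?_
  -- The value `0` arises both as a least element and as the default `sInf ∅`, hence the extra piece
  -- when `n = 0`.
  have : (fun a => sInf (S a)) ⁻¹' {n} =
      ({a | n ∈ S a} ∩ ⋂ j, ⋂ (_ : j < n), {a | j ∈ S a}ᶜ) ∪
        (if n = 0 then ⋂ j, {a | j ∈ S a}ᶜ else ∅) := by
    ext a
    simp only [Set.mem_preimage, Set.mem_singleton_iff, Set.mem_union, Set.mem_inter_iff,
      Set.mem_ofPred_eq, Set.mem_iInter, Set.mem_compl_iff]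
    constructor
    · rintro rfl
      rcases (S a).eq_empty_or_nonempty with h | h
      · right; simp [h]
      · exact Or.inl ⟨Nat.sInf_mem h, fun j hj => Nat.notMem_of_lt_sInf hj⟩
    · rintro (⟨h1, h2⟩ | h)
      · exact le_antisymm (Nat.sInf_le h1)
          (le_csInf ⟨_, h1⟩ fun b hb => not_lt.1 fun hlt => h2 b hlt hb)
      · split_ifs at h with h0
        · simp only [Set.mem_iInter, Set.mem_compl_iff, Set.mem_ofPred_eq] at h
          rw [Set.eq_empty_iff_forall_notMem.2 h, h0]
          simp
        · exact h.elim
  rw [this]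
  refine ((hS n).inter (.iInter fun j => .iInter fun _ => (hS j).compl)).union ?_
  split_ifs
  · exact .iInter fun j => (hS j).compl
  · exact .empty

/-- On `ℕ` the supremum is by definition the least upper bound, and both sides default to `0` when
there is none. Measurability of suprema thus reduces to that of infima. -/
theorem nat_sSup_eq_sInf (S : Set ℕ) : sSup S = sInf {k | ∀ j ∈ S, j ≤ k} := rfl

theorem measurable_nat_sSup {α : Type*} [MeasurableSpace α] {S : α → Set ℕ}
    (hS : ∀ k, MeasurableSet {a | k ∈ S a}) : Measurable fun a => sSup (S a) := by
  simp only [nat_sSup_eq_sInf]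
  refine measurable_nat_sInf fun k => ?_
  have : {a | k ∈ {k | ∀ j ∈ S a, j ≤ k}} = ⋂ j, ⋂ (_ : ¬ j ≤ k), {a | j ∈ S a}ᶜ := by
    ext a
    simp only [Set.mem_ofPred_eq, Set.mem_iInter, Set.mem_compl_iff]
    exact forall_congr' fun j => ⟨fun h h1 h2 => h1 (h h2), fun h h2 => by_contra fun h1 => h h1 h2⟩
  rw [this]
  exact .iInter fun j => .iInter fun _ => (hS j).compl

/-- Used for the random indices of the construction: the last legal ring, the first ring after a
time, the depth of freezing, the ring of a jump. A countable index makes separate measurability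
joint. -/
theorem measurable_eval_nat {α β : Type*} [MeasurableSpace α] [MeasurableSpace β] {n : α → ℕ}
    (hn : Measurable n) {f : ℕ → α → β} (hf : ∀ k, Measurable (f k)) :
    Measurable fun a => f (n a) a := by
  have h : Measurable fun p : ℕ × α => f p.1 p.2 := measurable_from_prod_countable_right hf
  exact h.comp (hn.prodMk measurable_id)

/-! ### The part of a clock after a given time -/

/-- The law of the marks of a single ring. -/
noncomputable def markLaw (q : I) : Measure (ℝ × Bool) := (expMeasure 1).prod (siteLaw q)

instance (q : I) : IsProbabilityMeasure (markLaw q) := by unfold markLaw; infer_instance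

/-- The law of the marks of a single site. -/
noncomputable def clockLaw (q : I) : Measure (ℕ → ℝ × Bool) :=
  Measure.infinitePi fun _ => markLaw q

instance (q : I) : IsProbabilityMeasure (clockLaw q) := by unfold clockLaw; infer_instance

/-- The time of the `k`-th ring of a clock with marks `u`. -/
def clockRing (u : ℕ → ℝ × Bool) (k : ℕ) : ℝ := ∑ j ∈ Finset.range (k + 1), (u j).1

theorem measurable_clockRing (k : ℕ) : Measurable fun u => clockRing u k := by
  unfold clockRing; fun_prop

/-- The index of the first ring not before time `T`. -/
noncomputable def firstAfter (u : ℕ → ℝ × Bool) (T : ℝ) : ℕ := sInf {k | T ≤ clockRing u k}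

/-- The marks seen from time `T` on, if the first ring from then on has index `k`. -/
def afterAt (k : ℕ) (u : ℕ → ℝ × Bool) (T : ℝ) : ℕ → ℝ × Bool :=
  fun l => if l = 0 then (clockRing u k - T, (u k).2) else u (k + l)

/-- The marks of a clock as seen from time `T` on. -/
noncomputable def after (u : ℕ → ℝ × Bool) (T : ℝ) : ℕ → ℝ × Bool := afterAt (firstAfter u T) u T

theorem measurable_firstAfter :
    Measurable fun p : (ℕ → ℝ × Bool) × ℝ => firstAfter p.1 p.2 := by
  refine measurable_nat_sInf fun k => ?_
  exact measurableSet_le measurable_snd ((measurable_clockRing k).comp measurable_fst)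

theorem measurable_afterAt (k : ℕ) :
    Measurable fun p : (ℕ → ℝ × Bool) × ℝ => afterAt k p.1 p.2 := by
  have := measurable_clockRing
  refine measurable_pi_lambda _ fun l => ?_
  unfold afterAt
  split_ifs <;> fun_prop

theorem measurable_after : Measurable fun p : (ℕ → ℝ × Bool) × ℝ => after p.1 p.2 :=
  measurable_eval_nat measurable_firstAfter measurable_afterAt

/-- The event that the first ring not before `T` has index `j`. -/
def firstAfterEvent (T : ℝ) (j : ℕ) : Set (ℕ → ℝ × Bool) :=
  {u | (∀ i < j, clockRing u i < T) ∧ T ≤ clockRing u j}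

theorem firstAfter_eq {T : ℝ} {j : ℕ} {u : ℕ → ℝ × Bool} (h : u ∈ firstAfterEvent T j) :
    firstAfter u T = j :=
  le_antisymm (Nat.sInf_le h.2)
    (le_csInf ⟨j, h.2⟩ fun _ hb => not_lt.1 fun hlt => not_lt.2 hb (h.1 _ hlt))

theorem mem_firstAfterEvent {T : ℝ} {u : ℕ → ℝ × Bool} (h : ∃ k, T ≤ clockRing u k) :
    u ∈ firstAfterEvent T (firstAfter u T) :=
  ⟨fun _ hi => not_le.1 fun hle => Nat.notMem_of_lt_sInf hi hle, Nat.sInf_mem h⟩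

theorem measurableSet_firstAfterEvent (T : ℝ) (j : ℕ) : MeasurableSet (firstAfterEvent T j) := by
  have h1 : firstAfterEvent T j =
      (⋂ i, ⋂ (_ : i < j), {u | clockRing u i < T}) ∩ {u | T ≤ clockRing u j} := by
    ext u; simp [firstAfterEvent]
  rw [h1]
  exact (MeasurableSet.iInter fun i => .iInter fun _ =>
    measurableSet_lt (measurable_clockRing i) measurable_const).inter
    (measurableSet_le measurable_const (measurable_clockRing j))

/-- A clock is almost surely made of positive waiting times. -/
theorem ae_clock_pos (q : I) : ∀ᵐ u ∂clockLaw q, ∀ k, 0 < (u k).1 := by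
  rw [ae_all_iff]
  intro k
  have h1 : ∀ᵐ a ∂markLaw q, 0 < a.1 := Measure.quasiMeasurePreserving_fst.ae exp_pos
  exact (measurePreserving_eval_infinitePi (fun _ : ℕ => markLaw q) k).quasiMeasurePreserving.ae h1

theorem clockRing_ge {u : ℕ → ℝ × Bool} (h : ∀ k, 0 < (u k).1) (k : ℕ) :
    (u k).1 ≤ clockRing u k :=
  Finset.single_le_sum (f := fun j => (u j).1) (fun j _ => (h j).le) (by simp)

theorem markLaw_ge_ne_zero (q : I) (M : ℝ) : markLaw q {a | M ≤ a.1} ≠ 0 := by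
  have h : {a : ℝ × Bool | M ≤ a.1} = Set.Ici M ×ˢ Set.univ := by ext; simp
  rw [h, markLaw, Measure.prod_prod, measure_univ, mul_one]
  refine ne_of_gt (lt_of_lt_of_le ?_ (measure_mono (Set.Ici_subset_Ici.2 (le_max_left M 0))))
  rw [exp_Ici _ (le_max_right _ _)]
  exact ENNReal.ofReal_pos.2 (Real.exp_pos _)

theorem measurableSet_mark_ge (M : ℝ) : MeasurableSet {a : ℝ × Bool | M ≤ a.1} :=
  measurableSet_le measurable_const measurable_fst

theorem ae_clock_unbounded (q : I) (M : ℝ) : ∀ᵐ u ∂clockLaw q, ∃ k, M ≤ clockRing u k := by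
  filter_upwards [ae_clock_pos q, ae_exists_coord_mem (markLaw q) (fun n : ℕ => n)
    Function.injective_id (measurableSet_mark_ge M) (markLaw_ge_ne_zero q M)] with u h1 ⟨k, hk⟩
  exact ⟨k, hk.trans (clockRing_ge h1 k)⟩

open Classical in
/-- The marks `v` up to index `j`, followed by the mark `a` and the shifted marks `w`. -/
noncomputable def concatMarks (j : ℕ) (v w : ℕ → ℝ × Bool) (a : ℝ × Bool) : ℕ → ℝ × Bool :=
  mix (Set.Iio j) (fun i => i - j) (v, Function.update w 0 a)

theorem measurePreserving_concatMarks (q : I) (j : ℕ) :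
    MeasurePreserving (fun p : (ℕ → ℝ × Bool) × (ℕ → ℝ × Bool) × (ℝ × Bool) =>
      concatMarks j p.1 p.2.1 p.2.2)
      ((clockLaw q).prod ((clockLaw q).prod (markLaw q))) (clockLaw q) := by
  classical
  have h1 := measurePreserving_mix (markLaw q) (Set.Iio j) (fun i => i - j) (by
    intro i hi k hk h
    simp only [Set.mem_compl_iff, Set.mem_Iio, not_lt] at hi hk h
    omega)
  have h2 := (MeasurePreserving.id (clockLaw q)).prod (measurePreserving_update (markLaw q) (0 : ℕ))
  exact h1.comp h2

theorem clockRing_concatMarks_lt {j i : ℕ} (hi : i < j) (v w : ℕ → ℝ × Bool) (a : ℝ × Bool) :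
    clockRing (concatMarks j v w a) i = clockRing v i := by
  refine Finset.sum_congr rfl fun k hk => ?_
  have : k < j := by have := Finset.mem_range.1 hk; omega
  simp [concatMarks, mix, this]

theorem clockRing_concatMarks_self (j : ℕ) (v w : ℕ → ℝ × Bool) (a : ℝ × Bool) :
    clockRing (concatMarks j v w a) j = (∑ i ∈ Finset.range j, (v i).1) + a.1 := by
  rw [clockRing, Finset.sum_range_succ]
  congr 1
  · refine Finset.sum_congr rfl fun k hk => ?_
    simp [concatMarks, mix, Finset.mem_range.1 hk]
  · simp [concatMarks, mix]

/-- The past `v` enters the clock seen from `T` only through the residual time `T - ∑ (v i).1`. With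
`v` and `w` fixed, the problem is reduced to the single exponential variable `a.1`. -/
theorem afterAt_concatMarks (j : ℕ) (v w : ℕ → ℝ × Bool) (a : ℝ × Bool) (T : ℝ) :
    afterAt j (concatMarks j v w a) T =
      Function.update w 0 (a.1 - (T - ∑ i ∈ Finset.range j, (v i).1), a.2) := by
  funext l
  by_cases hl : l = 0
  · subst hl
    simp only [afterAt, if_true, clockRing_concatMarks_self, Function.update_self]
    refine Prod.ext ?_ ?_
    · simp only; ring
    · simp [concatMarks, mix]
  · simp [afterAt, hl, concatMarks, mix]

theorem mark_memoryless (q : I) (s : ℝ) (hs : 0 ≤ s) {A : Set (ℝ × Bool)} (hA : MeasurableSet A) :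
    markLaw q {a | s ≤ a.1 ∧ (a.1 - s, a.2) ∈ A} = expMeasure 1 (Set.Ici s) * markLaw q A := by
  have hm : Measurable fun a : ℝ × Bool => (a.1 - s, a.2) := by fun_prop
  have h1 : {a : ℝ × Bool | s ≤ a.1 ∧ (a.1 - s, a.2) ∈ A} =
      (fun a : ℝ × Bool => (a.1 - s, a.2)) ⁻¹' A ∩ (Set.Ici s ×ˢ Set.univ) := by
    ext a; simp [and_comm]
  rw [h1, ← Measure.restrict_apply (hm hA), ← Measure.map_apply hm hA, markLaw,
    ← Measure.prod_restrict, Measure.restrict_univ]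
  have h2 := Measure.map_prod_map ((expMeasure 1).restrict (Set.Ici s)) (siteLaw q)
    (f := fun a : ℝ => a - s) (g := id) (by fun_prop) measurable_id
  rw [exp_memoryless s hs, Measure.map_id, Measure.prod_smul_left] at h2
  change Measure.map (Prod.map (fun a : ℝ => a - s) id) _ A = _
  rw [← h2, Measure.smul_apply, smul_eq_mul]

/-- Independence of the index of the first ring after `T` and of the clock seen from then on. Fix
the marks before index `j`: the event asks the `j`-th waiting time to exceed the residual time, and
by memorylessness its excess is again exponential, while the later marks are untouched. The factor
`c v` is the probability of the event given these marks. -/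
theorem clock_afterAt (q : I) {T : ℝ} (hT : 0 ≤ T) (j : ℕ) {A : Set (ℕ → ℝ × Bool)}
    (hA : MeasurableSet A) :
    clockLaw q (firstAfterEvent T j ∩ {u | afterAt j u T ∈ A}) =
      clockLaw q (firstAfterEvent T j) * clockLaw q A := by
  classical
  set c : (ℕ → ℝ × Bool) → ENNReal := fun v => if ∀ i < j, clockRing v i < T then
    expMeasure 1 (Set.Ici (T - ∑ i ∈ Finset.range j, (v i).1)) else 0 with hc
  have hmA : ∀ {A : Set (ℕ → ℝ × Bool)}, MeasurableSet A →
      MeasurableSet (firstAfterEvent T j ∩ {u | afterAt j u T ∈ A}) := fun {A} hA =>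
    (measurableSet_firstAfterEvent T j).inter
      (((measurable_afterAt j).comp (measurable_id.prodMk measurable_const)) hA)
  have key : ∀ {A : Set (ℕ → ℝ × Bool)}, MeasurableSet A →
      clockLaw q (firstAfterEvent T j ∩ {u | afterAt j u T ∈ A}) =
        (∫⁻ v, c v ∂clockLaw q) * clockLaw q A := by
    intro A hA
    have hmp := measurePreserving_concatMarks q j
    have hupd := measurePreserving_update (markLaw q) (0 : ℕ)
    rw [← hmp.measure_preimage (hmA hA).nullMeasurableSet,
      Measure.prod_apply (hmp.measurable (hmA hA))]
    have hA2 : clockLaw q A =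
        ∫⁻ w, markLaw q {a | Function.update w 0 a ∈ A} ∂clockLaw q := by
      rw [clockLaw, ← hupd.measure_preimage hA.nullMeasurableSet,
        Measure.prod_apply (hupd.measurable hA)]
      rfl
    rw [hA2, ← lintegral_mul_const']
    swap
    · rw [← hA2]; exact measure_ne_top _ _
    refine lintegral_congr fun v => ?_
    rw [Measure.prod_apply (measurable_prodMk_left (hmp.measurable (hmA hA))),
      ← lintegral_const_mul']
    swap
    · simp only [hc]; split_ifs <;> simp
    refine lintegral_congr fun w => ?_
    have hset : (Prod.mk w ⁻¹' (Prod.mk v ⁻¹'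
        ((fun p : (ℕ → ℝ × Bool) × (ℕ → ℝ × Bool) × (ℝ × Bool) => concatMarks j p.1 p.2.1 p.2.2) ⁻¹'
          (firstAfterEvent T j ∩ {u | afterAt j u T ∈ A})))) =
        {a | (∀ i < j, clockRing v i < T) ∧ (T - ∑ i ∈ Finset.range j, (v i).1) ≤ a.1 ∧
          (a.1 - (T - ∑ i ∈ Finset.range j, (v i).1), a.2) ∈ {a | Function.update w 0 a ∈ A}} := by
      ext a
      simp only [Set.mem_preimage, Set.mem_inter_iff, firstAfterEvent, Set.mem_ofPred_eq,
        clockRing_concatMarks_self, afterAt_concatMarks, and_assoc]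
      refine and_congr ?_ (and_congr ?_ Iff.rfl)
      · exact forall₂_congr fun i hi => by rw [clockRing_concatMarks_lt hi]
      · rw [sub_le_iff_le_add']
    rw [hset]
    by_cases hP : ∀ i < j, clockRing v i < T
    -- Memorylessness needs a nonnegative residual time: it is `T` itself if `j = 0`, and otherwise
    -- the sum is the ring of index `j - 1`, which is before `T`.
    · have hs : 0 ≤ T - ∑ i ∈ Finset.range j, (v i).1 := by
        rcases Nat.eq_zero_or_pos j with rfl | hj
        · simpa using hT
        · have := hP (j - 1) (by omega)
          rw [clockRing, Nat.sub_add_cancel hj] at this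
          linarith
      have := mark_memoryless q _ hs (A := {a | Function.update w 0 a ∈ A})
        ((hupd.measurable.comp measurable_prodMk_left) hA)
      simp only [hc, if_pos hP, ← this]
      congr 1
      ext a
      simp only [Set.mem_ofPred_eq]
      tauto
    · simp [hc, hP]
  -- The choice of the whole space identifies the integral of `c` with the probability of the event.
  have h1 := key MeasurableSet.univ
  simp only [Set.mem_univ, measure_univ, mul_one] at h1
  rw [key hA, ← h1]
  congr 2
  ext u; simp

/-- The part of a clock after a fixed time is again a clock with the same law. -/
theorem measurePreserving_after (q : I) {T : ℝ} (hT : 0 ≤ T) :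
    MeasurePreserving (fun u => after u T) (clockLaw q) (clockLaw q) := by
  have hm : Measurable fun u => after u T :=
    measurable_after.comp (measurable_id.prodMk measurable_const)
  refine ⟨hm, ?_⟩
  ext A hA
  rw [Measure.map_apply hm hA]
  have hdisj : Pairwise (Function.onFun Disjoint (firstAfterEvent T)) := by
    intro i j hij
    refine Set.disjoint_left.2 fun u hi hj => hij ?_
    rw [← firstAfter_eq hi, firstAfter_eq hj]
  have hcov : ∀ B : Set (ℕ → ℝ × Bool), clockLaw q B =
      clockLaw q (⋃ j, firstAfterEvent T j ∩ B) := by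
    intro B
    refine measure_congr ?_
    filter_upwards [ae_clock_unbounded q T] with u hu
    refine propext ⟨fun h => Set.mem_iUnion.2 ⟨_, mem_firstAfterEvent hu, h⟩, fun h => ?_⟩
    obtain ⟨j, -, h⟩ := Set.mem_iUnion.1 h
    exact h
  have hsum : ∑' j, clockLaw q (firstAfterEvent T j) = 1 := by
    rw [← measure_iUnion hdisj (measurableSet_firstAfterEvent T)]
    have := hcov Set.univ
    simpa using this.symm
  rw [hcov, measure_iUnion (fun i j hij => (hdisj hij).mono Set.inter_subset_left
    Set.inter_subset_left) fun j => (measurableSet_firstAfterEvent T j).inter (hm hA)]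
  have : ∀ j, clockLaw q (firstAfterEvent T j ∩ (fun u => after u T) ⁻¹' A) =
      clockLaw q (firstAfterEvent T j) * clockLaw q A := by
    intro j
    rw [← clock_afterAt q hT j hA]
    congr 1
    ext u
    refine and_congr_right fun hu => ?_
    simp only [Set.mem_preimage, Set.mem_ofPred_eq, after, firstAfter_eq hu]
  simp only [this, ENNReal.tsum_mul_right, hsum, one_mul]


/-! ### Marks without degeneracies -/

/-- Marks with positive waiting times, finitely many rings of each clock in bounded time, and, for
every time, sites arbitrarily far to the right that have not rung up to this time. -/
structure GoodMarks (m : Marks) : Prop where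
  pos : ∀ i, 0 < (m i).1
  unbounded : ∀ y (M : ℝ), ∃ k, M < ring m y k
  quiet : ∀ y (s : ℝ), ∃ n : ℕ, ∀ k, s < ring m (y + n) k

theorem ring_succ (m : Marks) (y : ℤ) (k : ℕ) :
    ring m y (k + 1) = ring m y k + (m (y, k + 1)).1 := Finset.sum_range_succ _ _

theorem ring_strictMono {m : Marks} (hm : GoodMarks m) (y : ℤ) : StrictMono (ring m y) :=
  strictMono_nat_of_lt_succ fun k => by
    rw [ring_succ]; exact lt_add_of_pos_right _ (hm.pos _)

theorem ring_pos {m : Marks} (hm : GoodMarks m) (y : ℤ) (k : ℕ) : 0 < ring m y k :=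
  Finset.sum_pos (fun _ _ => hm.pos _) (by simp)

theorem bddAbove_of_ring_le {m : Marks} (hm : GoodMarks m) {y : ℤ} {s : ℝ} {L : Set ℕ}
    (hL : ∀ k ∈ L, ring m y k ≤ s) : BddAbove L := by
  obtain ⟨K, hK⟩ := hm.unbounded y s
  refine ⟨K, fun k hk => ?_⟩
  exact ((ring_strictMono hm y).lt_iff_lt.1 ((hL k hk).trans_lt hK)).le

theorem updated_empty (v : Bool) {L : Set ℕ} (hL : ∀ k, k ∉ L) (c : ℕ → Bool) :
    updated v L c = v := by
  rw [updated, if_neg (by rintro ⟨k, hk⟩; exact hL k hk)]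

theorem updated_of_isGreatest (v : Bool) {L : Set ℕ} {k : ℕ} (hk : IsGreatest L k) (c : ℕ → Bool) :
    updated v L c = c k := by
  rw [updated, if_pos ⟨k, hk.1⟩, hk.csSup_eq]

theorem exists_isGreatest {L : Set ℕ} (h : L.Nonempty) (hb : BddAbove L) : ∃ k, IsGreatest L k :=
  ⟨sSup L, Nat.sSup_mem h hb, fun _ hk => le_csSup hb hk⟩

theorem updated_congr {v v' : Bool} {L L' : Set ℕ} {c c' : ℕ → Bool} (hv : v = v')
    (hL : ∀ k, k ∈ L ↔ k ∈ L') (hb : BddAbove L) (hc : ∀ k ∈ L, c k = c' k) :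
    updated v L c = updated v' L' c' := by
  obtain rfl : L = L' := Set.ext hL
  subst hv
  rcases L.eq_empty_or_nonempty with h | h
  · rw [updated_empty v (by simp [h]), updated_empty v (by simp [h])]
  · obtain ⟨k, hk⟩ := exists_isGreatest h hb
    rw [updated_of_isGreatest v hk, updated_of_isGreatest v hk, hc k hk.1]

/-! ### The East process solves its defining equation -/

/-- A site that is silent up to time `s` is in its initial state throughout, so freezing a site
further to the right makes no difference. Silence passes to the earlier ring times queried by the
recursion. -/
theorem frozen_add (ω : Config) (m : Marks) (b a : ℕ) (y : ℤ) (s : ℝ)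
    (h : ∀ k, s < ring m (y + a) k) : frozen ω m (a + b) y s = frozen ω m a y s := by
  induction a generalizing y s with
  | zero =>
    rcases b with _ | b
    · rfl
    · rw [Nat.zero_add, frozen, frozen, updated_empty]
      rintro k ⟨hk, -⟩
      exact absurd (h k) (by simpa using hk)
  | succ a ih =>
    rw [Nat.add_right_comm, frozen, frozen]
    congr 1
    ext k
    refine and_congr_right fun hk => ?_
    rw [ih]
    intro j
    refine hk.trans_lt ?_
    have := h j
    rwa [Nat.cast_succ, add_comm (a : ℤ), ← add_assoc] at this

theorem eta_eq_frozen (ω : Config) (m : Marks) (a : ℕ) (y : ℤ) (s : ℝ)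
    (h : ∀ k, s < ring m (y + a) k) : eta ω m s y = frozen ω m a y s := by
  rw [eta]
  set b := sInf {n : ℕ | ∀ k, s < ring m (y + n) k} with hb
  have h1 : b ∈ {n : ℕ | ∀ k, s < ring m (y + n) k} := Nat.sInf_mem ⟨a, h⟩
  have h2 : b ≤ a := Nat.sInf_le h
  obtain ⟨c, rfl⟩ := Nat.exists_eq_add_of_le h2
  exact (frozen_add ω m c b y s h1).symm

/-- The graphical construction satisfies its one-step recursion exactly: one silent site to the
right serves for both `y` and `y + 1`. Arguments about the dynamics can then use this equation
instead of the truncation `frozen`. -/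
theorem eta_eq {m : Marks} (hm : GoodMarks m) (ω : Config) (s : ℝ) (y : ℤ) :
    eta ω m s y = updated (ω y)
      {k | ring m y k ≤ s ∧ eta ω m (ring m y k) (y + 1) = false} (coin m y) := by
  obtain ⟨n, hn⟩ := hm.quiet (y + 1) s
  rw [eta_eq_frozen ω m (n + 1) y s (fun k => by
    rw [Nat.cast_succ, add_comm (n : ℤ), ← add_assoc]; exact hn k), frozen]
  congr 1
  ext k
  refine and_congr_right fun hk => ?_
  rw [eta_eq_frozen ω m n (y + 1) _ fun j => hk.trans_lt (hn j)]

theorem frozen_congr {ω ω' : Config} {m m' : Marks} {y : ℤ} (hω : ∀ z, y ≤ z → ω z = ω' z)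
    (hm : ∀ z, y ≤ z → ∀ k, m (z, k) = m' (z, k)) (n : ℕ) (s : ℝ) :
    frozen ω m n y s = frozen ω' m' n y s := by
  induction n generalizing y s with
  | zero => exact hω y le_rfl
  | succ n ih =>
    have hr : ∀ k, ring m y k = ring m' y k := fun k =>
      Finset.sum_congr rfl fun j _ => by rw [hm y le_rfl]
    have hc : coin m y = coin m' y := by
      funext k; simp only [coin, hm y le_rfl]
    rw [frozen, frozen, hω y le_rfl, hc]
    congr 1
    ext k
    simp only [Set.mem_ofPred_eq, hr]
    rw [ih (fun z hz => hω z (by omega)) (fun z hz => hm z (by omega))]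

/-- The state of a site is a function of what is to its right. -/
theorem eta_congr {ω ω' : Config} {m m' : Marks} {y : ℤ} (hω : ∀ z, y ≤ z → ω z = ω' z)
    (hm : ∀ z, y ≤ z → ∀ k, m (z, k) = m' (z, k)) (s : ℝ) :
    eta ω m s y = eta ω' m' s y := by
  have hr : ∀ n k, ring m (y + (n : ℕ)) k = ring m' (y + (n : ℕ)) k := fun n k =>
    Finset.sum_congr rfl fun j _ => by rw [hm _ (by omega)]
  rw [eta, eta, frozen_congr hω hm]
  simp only [hr]

/-! ### The jump times of the distinguished zero -/

section jump

variable {ω : Config} {m : Marks} {x : ℤ}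

theorem jumpTime_succ_le {i k : ℕ} (h1 : jumpTime ω m x i < (ring m (x + i) k : EReal))
    (h2 : eta ω m (ring m (x + i) k) (x + i + 1) = false) :
    jumpTime ω m x (i + 1) ≤ (ring m (x + i) k : EReal) :=
  iInf₂_le k ⟨h1, h2⟩

/-- The infimum is attained when finite: the rings of a clock increase with their index, so the
least admissible index realizes it. -/
theorem jumpTime_succ_cases (hm : GoodMarks m) (i : ℕ) :
    jumpTime ω m x (i + 1) = ⊤ ∨ ∃ k, jumpTime ω m x (i + 1) = (ring m (x + i) k : EReal) ∧
      jumpTime ω m x i < (ring m (x + i) k : EReal) ∧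
      eta ω m (ring m (x + i) k) (x + i + 1) = false := by
  classical
  by_cases h : ∃ k, jumpTime ω m x i < (ring m (x + i) k : EReal) ∧
      eta ω m (ring m (x + i) k) (x + i + 1) = false
  · refine Or.inr ⟨Nat.find h, ?_, Nat.find_spec h⟩
    refine le_antisymm (jumpTime_succ_le (Nat.find_spec h).1 (Nat.find_spec h).2) ?_
    refine le_iInf₂ fun k hk => ?_
    exact EReal.coe_le_coe_iff.2 ((ring_strictMono hm _).monotone (Nat.find_min' h hk))
  · left
    push Not at h
    refine iInf₂_eq_top.2 fun k hk => absurd hk.2 (h k hk.1)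

theorem jumpTime_lt_succ (hm : GoodMarks m) {i : ℕ} (h : jumpTime ω m x i < ⊤) :
    jumpTime ω m x i < jumpTime ω m x (i + 1) := by
  rcases jumpTime_succ_cases (ω := ω) (x := x) hm i with h1 | ⟨k, h1, h2, -⟩
  · rwa [h1]
  · rwa [h1]

theorem jumpTime_mono (hm : GoodMarks m) : Monotone (jumpTime ω m x) := by
  refine monotone_nat_of_le_succ fun i => ?_
  rcases eq_or_ne (jumpTime ω m x i) ⊤ with h | h
  · refine le_iInf₂ fun k hk => ?_
    rw [h] at hk
    exact absurd hk.1 not_top_lt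
  · exact (jumpTime_lt_succ hm (lt_top_iff_ne_top.2 h)).le

theorem dz_eq (hm : GoodMarks m) {i : ℕ} {s : ℝ} (h1 : jumpTime ω m x i ≤ (s : EReal))
    (h2 : (s : EReal) < jumpTime ω m x (i + 1)) : dz ω m x s = x + i := by
  have h : IsGreatest {n : ℕ | jumpTime ω m x n ≤ (s : EReal)} i := by
    refine ⟨h1, fun n hn => ?_⟩
    by_contra hlt
    exact absurd (h2.trans_le (jumpTime_mono hm (by omega : i + 1 ≤ n))) (not_lt.2 hn)
  rw [dz, h.csSup_eq]

/-- The zero cannot pass a site that has not rung by time `s`, so a quiet site to the right bounds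
the number of jumps. -/
theorem exists_jumpTime_index (hm : GoodMarks m) {s : ℝ} (hs : 0 ≤ s) :
    ∃ i, jumpTime ω m x i ≤ (s : EReal) ∧ (s : EReal) < jumpTime ω m x (i + 1) := by
  classical
  have h : ∃ n, (s : EReal) < jumpTime ω m x n := by
    obtain ⟨n, hn⟩ := hm.quiet x s
    refine ⟨n + 1, ?_⟩
    rcases jumpTime_succ_cases (ω := ω) (x := x) hm n with h1 | ⟨k, h1, -⟩
    · rw [h1]; exact EReal.coe_lt_top s
    · rw [h1]; exact EReal.coe_lt_coe_iff.2 (hn k)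
  have h0 : Nat.find h ≠ 0 := by
    intro h0
    have := Nat.find_spec h
    rw [h0] at this
    exact absurd this (not_lt.2 (by rw [jumpTime]; exact_mod_cast hs))
  obtain ⟨i, hi⟩ := Nat.exists_eq_succ_of_ne_zero h0
  refine ⟨i, not_lt.1 (Nat.find_min h (by omega)), ?_⟩
  have := Nat.find_spec h
  rwa [hi] at this

theorem le_dz_iff (hm : GoodMarks m) {i : ℕ} {s : ℝ} (hs : 0 ≤ s) :
    x + i ≤ dz ω m x s ↔ jumpTime ω m x i ≤ (s : EReal) := by
  obtain ⟨n, h1, h2⟩ := exists_jumpTime_index (ω := ω) (x := x) hm hs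
  rw [dz_eq hm h1 h2]
  constructor
  · intro h
    exact (jumpTime_mono hm (by omega : i ≤ n)).trans h1
  · intro h
    by_contra hlt
    exact absurd (h2.trans_le (jumpTime_mono hm (by omega : n + 1 ≤ i))) (not_lt.2 h)

theorem dz_mono (hm : GoodMarks m) {r s : ℝ} (hr : 0 ≤ r) (hrs : r ≤ s) :
    dz ω m x r ≤ dz ω m x s := by
  obtain ⟨n, h1, h2⟩ := exists_jumpTime_index (ω := ω) (x := x) hm hr
  rw [dz_eq hm h1 h2, le_dz_iff hm (hr.trans hrs)]
  exact h1.trans (EReal.coe_le_coe_iff.2 hrs)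

theorem le_dz (s : ℝ) : x ≤ dz ω m x s := by
  rw [dz]; omega

/-- The site of the distinguished zero is empty. -/
theorem eta_dz (hm : GoodMarks m) (hx : ω x = false) {s : ℝ} (hs : 0 ≤ s) :
    eta ω m s (dz ω m x s) = false := by
  obtain ⟨i, h1, h2⟩ := exists_jumpTime_index (ω := ω) (x := x) hm hs
  rw [dz_eq hm h1 h2]
  have key : ∀ k, ring m (x + i) k ≤ s → eta ω m (ring m (x + i) k) (x + i + 1) = false →
      (ring m (x + i) k : EReal) ≤ jumpTime ω m x i := by
    intro k hk he
    by_contra hlt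
    exact absurd (h2.trans_le (jumpTime_succ_le (not_le.1 hlt) he))
      (not_lt.2 (EReal.coe_le_coe_iff.2 hk))
  rcases i with _ | i
  · rw [eta_eq hm, updated_empty]
    · simpa using hx
    · rintro k ⟨hk, he⟩
      have := key k hk he
      rw [jumpTime] at this
      exact absurd (ring_pos hm _ k) (not_lt.2 (by exact_mod_cast this))
  · rcases jumpTime_succ_cases (ω := ω) (x := x) hm i with h | ⟨K, h3, h4, h5⟩
    · rw [h] at h1
      exact absurd (top_le_iff.1 h1) (EReal.coe_ne_top s)
    -- There is no legal ring at the current site after the arrival time and up to `s`, so its state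
    -- is that at the arrival. It was empty then, since the ring that moved the zero was legal.
    · rw [h3] at key h1
      rw [Nat.cast_succ, ← add_assoc] at key ⊢
      rw [← h5, eta_eq hm, eta_eq hm ω (ring m (x + i) K)]
      congr 1
      ext k
      constructor
      · rintro ⟨hk, he⟩
        exact ⟨EReal.coe_le_coe_iff.1 (key k hk he), he⟩
      · rintro ⟨hk, he⟩
        exact ⟨hk.trans (EReal.coe_le_coe_iff.1 h1), he⟩

end jump

/-! ### Stability of the jump times -/

/-- `(ω', m')` agrees with `(ω, m)` on what determines the trajectory of the distinguished zero
of `(ω, m)`: at the site `x + i`, the waiting times up to the jump time `t_{i+1}` and the coins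
before it. -/
structure AgreesBefore (x : ℤ) (ω ω' : Config) (m m' : Marks) : Prop where
  init : ∀ z, x ≤ z → ω' z = ω z
  wait : ∀ (i : ℕ) j, (ring m (x + i) j : EReal) ≤ jumpTime ω m x (i + 1) →
    (m' (x + i, j)).1 = (m (x + i, j)).1
  toss : ∀ (i : ℕ) j, (ring m (x + i) j : EReal) < jumpTime ω m x (i + 1) →
    coin m' (x + i) j = coin m (x + i) j

section agree

variable {x : ℤ} {ω ω' : Config} {m m' : Marks}

theorem AgreesBefore.ring_eq (h : AgreesBefore x ω ω' m m') (hm : GoodMarks m) {i j : ℕ}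
    (hj : (ring m (x + i) j : EReal) ≤ jumpTime ω m x (i + 1)) :
    ring m' (x + i) j = ring m (x + i) j := by
  refine Finset.sum_congr rfl fun k hk => h.wait i k (le_trans ?_ hj)
  exact EReal.coe_le_coe_iff.2
    ((ring_strictMono hm _).monotone (Nat.lt_succ_iff.1 (Finset.mem_range.1 hk)))

/-- The converse direction, where the bound is on the ring of `m'`. The ring of the jump is common
to both clocks, so a larger index would ring after it for `m'` as well. -/
theorem AgreesBefore.ring_eq' (h : AgreesBefore x ω ω' m m') (hm : GoodMarks m)
    (hm' : GoodMarks m') {i j : ℕ}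
    (hj : (ring m' (x + i) j : EReal) ≤ jumpTime ω m x (i + 1)) :
    ring m' (x + i) j = ring m (x + i) j := by
  refine h.ring_eq hm ?_
  by_contra hlt
  rw [not_le] at hlt
  rcases jumpTime_succ_cases (ω := ω) (x := x) hm i with h1 | ⟨K, h1, -⟩
  · rw [h1] at hlt
    exact not_top_lt hlt
  · have hK := h.ring_eq hm h1.ge
    rw [h1] at hj hlt
    have h2 : K < j := (ring_strictMono hm _).lt_iff_lt.1 (EReal.coe_lt_coe_iff.1 hlt)
    have h3 := ring_strictMono hm' (x + i) h2
    rw [hK] at h3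
    exact absurd h3 (not_lt.2 (EReal.coe_le_coe_iff.1 hj))

theorem AgreesBefore.ring_le_iff (h : AgreesBefore x ω ω' m m') (hm : GoodMarks m)
    (hm' : GoodMarks m') {i j : ℕ} {s : ℝ} (hs : (s : EReal) ≤ jumpTime ω m x (i + 1)) :
    ring m' (x + i) j ≤ s ↔ ring m (x + i) j ≤ s := by
  constructor
  · intro hj
    rwa [h.ring_eq' hm hm' ((EReal.coe_le_coe_iff.2 hj).trans hs)] at hj
  · intro hj
    rwa [h.ring_eq hm ((EReal.coe_le_coe_iff.2 hj).trans hs)]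

/-- Before `t_{i+1}` the state of `x + i` depends on its own coins before that time, which agree,
and on `x + i + 1` at earlier times. These times precede `t_{i+2}` because jump times are ordered,
so the induction moves to the right. -/
theorem AgreesBefore.frozen_eq (h : AgreesBefore x ω ω' m m') (hm : GoodMarks m)
    (hm' : GoodMarks m') (n i : ℕ) {s : ℝ} (hs : (s : EReal) < jumpTime ω m x (i + 1)) :
    frozen ω' m' n (x + i) s = frozen ω m n (x + i) s := by
  induction n generalizing i s with
  | zero => exact h.init _ (by omega)
  | succ n ih =>
    rw [frozen, frozen]
    refine updated_congr (h.init _ (by omega)) (fun k => ?_)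
      (bddAbove_of_ring_le hm' fun k hk => hk.1) fun k hk => ?_
    · simp only [Set.mem_ofPred_eq, h.ring_le_iff hm hm' hs.le]
      refine and_congr_right fun hk => ?_
      have hk' : (ring m (x + i) k : EReal) < jumpTime ω m x (i + 1) :=
        (EReal.coe_le_coe_iff.2 hk).trans_lt hs
      have := ih (i + 1) (hk'.trans_le (jumpTime_mono hm (Nat.le_succ _)))
      rw [Nat.cast_succ, ← add_assoc] at this
      rw [h.ring_eq hm hk'.le, this]
    · exact h.toss i k ((EReal.coe_le_coe_iff.2 ((h.ring_le_iff hm hm' hs.le).1 hk.1)).trans_lt hs)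

theorem AgreesBefore.eta_eq (h : AgreesBefore x ω ω' m m') (hm : GoodMarks m)
    (hm' : GoodMarks m') (i : ℕ) {s : ℝ} (hs : (s : EReal) < jumpTime ω m x (i + 1)) :
    eta ω' m' s (x + i) = eta ω m s (x + i) := by
  rw [eta, eta, h.frozen_eq hm hm' _ i hs]
  congr 2
  ext n
  refine forall_congr' fun k => not_iff_not.1 ?_
  rw [not_lt, not_lt]
  have := h.ring_le_iff hm hm' (i := i + n) (j := k) (s := s)
    (hs.le.trans (jumpTime_mono hm (by omega)))
  rwa [Nat.cast_add, ← add_assoc] at this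

theorem AgreesBefore.eta_ring_eq (h : AgreesBefore x ω ω' m m') (hm : GoodMarks m)
    (hm' : GoodMarks m') {i : ℕ} {s : ℝ} (hs : (s : EReal) ≤ jumpTime ω m x (i + 1)) :
    eta ω' m' s (x + i + 1) = eta ω m s (x + i + 1) := by
  -- Equality `s = t_{i+1}` is allowed here, since the right neighbour agrees up to the strictly
  -- later `t_{i+2}`. If `t_{i+1} = ⊤` the inequality is not strict between jump times, but `s` is
  -- finite.
  have hlt : (s : EReal) < jumpTime ω m x (i + 1 + 1) := by
    rcases eq_or_ne (jumpTime ω m x (i + 1)) ⊤ with h1 | h1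
    · refine lt_of_lt_of_le (EReal.coe_lt_top s) ?_
      rw [← h1]
      exact jumpTime_mono hm (Nat.le_succ _)
    · exact hs.trans_lt (jumpTime_lt_succ hm (lt_top_iff_ne_top.2 h1))
  have := h.eta_eq hm hm' (i + 1) hlt
  rwa [Nat.cast_succ, ← add_assoc] at this

/-- The jump times are determined by what `AgreesBefore` controls. -/
theorem AgreesBefore.jumpTime_eq (h : AgreesBefore x ω ω' m m') (hm : GoodMarks m)
    (hm' : GoodMarks m') (i : ℕ) : jumpTime ω' m' x i = jumpTime ω m x i := by
  induction i with
  | zero => rfl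
  | succ i ih =>
    refine le_antisymm ?_ ?_
    · rcases jumpTime_succ_cases (ω := ω) (x := x) hm i with h1 | ⟨K, h1, h2, h3⟩
      · rw [h1]; exact le_top
      · have hK := h.ring_eq hm h1.ge
        rw [h1, ← hK]
        refine jumpTime_succ_le ?_ ?_
        · rw [ih, hK]; exact h2
        · rw [hK, h.eta_ring_eq hm hm' h1.ge]; exact h3
    · rcases jumpTime_succ_cases (ω := ω') (x := x) hm' i with h1 | ⟨K, h1, h2, h3⟩
      · rw [h1]; exact le_top
      · by_contra hlt
        rw [not_le, h1] at hlt
        have hK := h.ring_eq' hm hm' hlt.le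
        rw [h.eta_ring_eq hm hm' hlt.le] at h3
        rw [hK] at h2 h3 hlt
        rw [ih] at h2
        exact absurd hlt (not_lt.2 (jumpTime_succ_le h2 h3))

theorem AgreesBefore.dz_eq (h : AgreesBefore x ω ω' m m') (hm : GoodMarks m)
    (hm' : GoodMarks m') : dz ω' m' x = dz ω m x := by
  funext s
  simp only [dz, h.jumpTime_eq hm hm']

end agree

/-! ### The process on the growing half-line -/

/-- Once the recursion depth covers the distance to the boundary, more depth changes nothing.
Monotonicity of `θ` ensures that at the earlier ring times the boundary is no further away. -/
theorem eastLeftAux_add {θ : ℝ → ℤ} {ρ : Config} {m : Marks} (hm : GoodMarks m)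
    (hθ : ∀ r s, 0 ≤ r → r ≤ s → θ r ≤ θ s) (b n : ℕ) (y : ℤ) (s : ℝ) (h : θ s - y ≤ n) :
    eastLeftAux θ ρ m (n + b) y s = eastLeftAux θ ρ m n y s := by
  induction n generalizing y s with
  | zero =>
    rcases b with _ | b
    · rfl
    · rw [Nat.zero_add, eastLeftAux, eastLeftAux, if_neg (by push_cast at h; omega)]
  | succ n ih =>
    rw [Nat.add_right_comm, eastLeftAux, eastLeftAux]
    split_ifs
    · congr 1
      ext k
      refine and_congr_right fun hk => and_congr_right fun _ => ?_
      have := hθ _ _ (ring_pos hm y k).le hk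
      rw [ih _ _ (by push_cast at h; omega)]
    · rfl

theorem eastLeft_eq_aux {θ : ℝ → ℤ} {ρ : Config} {m : Marks} (hm : GoodMarks m)
    (hθ : ∀ r s, 0 ≤ r → r ≤ s → θ r ≤ θ s) (n : ℕ) (y : ℤ) (s : ℝ) (h : θ s - y ≤ n) :
    eastLeft θ ρ m s y = eastLeftAux θ ρ m n y s := by
  rw [eastLeft]
  obtain ⟨b, hb⟩ := Nat.exists_eq_add_of_le (show (θ s - y).toNat ≤ n by omega)
  rw [hb, eastLeftAux_add hm hθ _ _ _ _ (by omega)]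

theorem eastLeft_of_le {θ : ℝ → ℤ} {ρ : Config} {m : Marks} {s : ℝ} {y : ℤ} (h : θ s ≤ y) :
    eastLeft θ ρ m s y = false := by
  rw [eastLeft, show (θ s - y).toNat = 0 by omega, eastLeftAux]

theorem eastLeft_eq {θ : ℝ → ℤ} {ρ : Config} {m : Marks} (hm : GoodMarks m)
    (hθ : ∀ r s, 0 ≤ r → r ≤ s → θ r ≤ θ s) {y : ℤ} {s : ℝ} (h : y < θ s) :
    eastLeft θ ρ m s y = updated (ρ y) {k | ring m y k ≤ s ∧ y < θ (ring m y k) ∧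
      eastLeft θ ρ m (ring m y k) (y + 1) = false} (coin m y) := by
  obtain ⟨n, hn⟩ := Int.le.dest (Int.add_one_le_of_lt h)
  rw [eastLeft_eq_aux hm hθ (n + 1) y s (by push_cast; omega), eastLeftAux, if_pos h]
  congr 1
  ext k
  refine and_congr_right fun hk => and_congr_right fun _ => ?_
  have := hθ _ _ (ring_pos hm y k).le hk
  rw [eastLeft_eq_aux hm hθ n (y + 1) _ (by omega)]

/-- Only the boundary path on `[0, t]` matters, so the trajectory can be replaced by a version
rebuilt from its values on this interval. -/
theorem eastLeft_congr {θ θ' : ℝ → ℤ} {ρ : Config} {m : Marks} (hm : GoodMarks m) {t : ℝ}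
    (h : ∀ s, 0 ≤ s → s ≤ t → θ s = θ' s) {s : ℝ} (h0 : 0 ≤ s) (ht : s ≤ t) :
    eastLeft θ ρ m s = eastLeft θ' ρ m s := by
  have key : ∀ n y s, 0 ≤ s → s ≤ t → eastLeftAux θ ρ m n y s = eastLeftAux θ' ρ m n y s := by
    intro n
    induction n with
    | zero => intros; rfl
    | succ n ih =>
      intro y s h0 ht
      rw [eastLeftAux, eastLeftAux, h s h0 ht]
      congr 2
      ext k
      refine and_congr_right fun hk => ?_
      rw [h _ (ring_pos hm y k).le (hk.trans ht), ih _ _ (ring_pos hm y k).le (hk.trans ht)]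
  funext y
  rw [eastLeft, eastLeft, h s h0 ht, key _ _ _ h0 ht]

/-! ### Splicing -/

/-- The clock of `m` at `z` tosses the coin `β z` at its ring of index `K` and continues
afterwards with the marks of `m'`. -/
def Spliced (m m' : Marks) (β : Config) (z : ℤ) (K : ℕ) : Prop :=
  coin m z K = β z ∧ ∀ l, m (z, K + 1 + l) = after (fun j => m' (z, j)) (ring m z K) l

/-- Ring `K` is legal and erases the past: from then on the state is the coin `β z`, overwritten by
the legal rings of `m'` from that time on. Ring `K + 1 + l` of `m` is ring `f + l` of `m'`, with the
same time and coin, so the last legal rings correspond. The predicate `P` stands for legality at a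
given time. -/
theorem updated_spliced {m m' : Marks} (hm' : GoodMarks m') {β : Config}
    {z : ℤ} {K : ℕ} (h : Spliced m m' β z K) (P : ℝ → Prop) (hP : P (ring m z K)) {s : ℝ}
    (hs : ring m z K ≤ s) (v : Bool) :
    updated v {k | ring m z k ≤ s ∧ P (ring m z k)} (coin m z) =
      updated (β z) {k | ring m' z k ≤ s ∧ ring m z K ≤ ring m' z k ∧ P (ring m' z k)}
        (coin m' z) := by
  set T := ring m z K with hT
  set f := firstAfter (fun j => m' (z, j)) T with hf
  obtain ⟨j, hj⟩ := hm'.unbounded z T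
  have hfe := mem_firstAfterEvent (T := T) (u := fun j => m' (z, j)) ⟨j, hj.le⟩
  rw [← hf] at hfe
  have F1 : ∀ l, ring m z (K + 1 + l) = ring m' z (f + l) := by
    intro l
    induction l with
    | zero =>
      rw [Nat.add_zero, Nat.add_zero, ring_succ, ← hT]
      have := h.2 0
      rw [Nat.add_zero] at this
      rw [this]
      simp only [after, afterAt, if_true, ← hf, ← hT]
      exact add_sub_cancel _ _
    | succ l ih =>
      rw [← Nat.add_assoc, ring_succ, ih, ← Nat.add_assoc, ring_succ]
      have := h.2 (l + 1)
      rw [← Nat.add_assoc] at this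
      rw [this]
      simp only [after, afterAt, Nat.add_one_ne_zero, if_false, ← hf, ← hT, Nat.add_assoc]
  have F2 : ∀ l, coin m z (K + 1 + l) = coin m' z (f + l) := by
    intro l
    rw [coin, h.2 l, ← hT, after, ← hf, afterAt]
    split_ifs with hl
    · subst hl; rfl
    · rfl
  have F3 : ∀ k, T ≤ ring m' z k → f ≤ k := fun k hk => Nat.sInf_le hk
  have F4 : ∀ l, T ≤ ring m' z (f + l) := fun l =>
    hfe.2.trans ((ring_strictMono hm' z).monotone (Nat.le_add_right f l))
  have hmem : ∀ l, K + 1 + l ∈ {k | ring m z k ≤ s ∧ P (ring m z k)} ↔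
      f + l ∈ {k | ring m' z k ≤ s ∧ T ≤ ring m' z k ∧ P (ring m' z k)} := by
    intro l
    simp only [Set.mem_ofPred_eq, F1, F4, true_and]
  have hshift : ∀ k, ¬ k ≤ K → ∃ l, k = K + 1 + l := fun k hk =>
    Nat.exists_eq_add_of_le (Nat.lt_of_not_le hk)
  rcases Set.eq_empty_or_nonempty {k | ring m' z k ≤ s ∧ T ≤ ring m' z k ∧ P (ring m' z k)}
    with h0 | h0
  · rw [h0, updated_empty (β z) (L := ∅) (by simp), ← h.1]
    have hK : IsGreatest {k | ring m z k ≤ s ∧ P (ring m z k)} K := by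
      refine ⟨⟨hs, hP⟩, fun k hk => ?_⟩
      by_contra hlt
      obtain ⟨l, rfl⟩ := hshift k hlt
      have := (hmem l).1 hk
      rw [h0] at this
      exact this
    exact updated_of_isGreatest v hK _
  · obtain ⟨g, hg⟩ := exists_isGreatest h0 (bddAbove_of_ring_le hm' fun k hk => hk.1)
    obtain ⟨l, rfl⟩ := Nat.exists_eq_add_of_le (F3 g hg.1.2.1)
    rw [updated_of_isGreatest _ hg, ← F2]
    have hl : IsGreatest {k | ring m z k ≤ s ∧ P (ring m z k)} (K + 1 + l) := by
      refine ⟨(hmem l).2 hg.1, fun k hk => ?_⟩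
      by_cases hlt : k ≤ K
      · omega
      · obtain ⟨l', rfl⟩ := hshift k hlt
        have := hg.2 ((hmem l').1 hk)
        omega
    exact updated_of_isGreatest v hl _

/-- For spliced marks, the process to the left of the distinguished zero is the East process on
the growing half-line. -/
theorem eta_eq_eastLeft {m m' : Marks} (hm : GoodMarks m) (hm' : GoodMarks m') {ω β : Config}
    {x : ℤ} (hx : ω x = false) (hl : ∀ y < x, ∀ k, m (y, k) = m' (y, k)) {N : ℕ}
    (hs : ∀ i < N, ∀ K, jumpTime ω m x (i + 1) = (ring m (x + i) K : EReal) →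
      Spliced m m' β (x + i) K) {s : ℝ} (h0 : 0 ≤ s) (hN : dz ω m x s ≤ x + N) {y : ℤ}
    (hy : y < dz ω m x s) :
    eta ω m s y = eastLeft (dz ω m x) (joinAt x ω β) m' s y := by
  have hθ : ∀ r s, 0 ≤ r → r ≤ s → dz ω m x r ≤ dz ω m x s := fun r s => dz_mono hm
  obtain ⟨n, hn⟩ := Int.le.dest (Int.add_one_le_of_lt hy)
  -- Induction on the distance to the zero. It is strong because at an earlier time the zero may be
  -- several sites closer.
  induction n using Nat.strong_induction_on generalizing y s with
  | _ n ih =>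
  have hnext : ∀ r, 0 ≤ r → r ≤ s → y < dz ω m x r →
      eta ω m r (y + 1) = eastLeft (dz ω m x) (joinAt x ω β) m' r (y + 1) := by
    intro r hr0 hrs hyr
    have hrs' := hθ r s hr0 hrs
    rcases (Int.add_one_le_of_lt hyr).eq_or_lt with h | h
    · rw [h, eta_dz hm hx hr0, eastLeft_of_le le_rfl]
    · obtain ⟨n', hn'⟩ := Int.le.dest (Int.add_one_le_of_lt h)
      exact ih n' (by omega) hr0 (hrs'.trans hN) h hn'
  rw [eastLeft_eq hm' hθ hy, eta_eq hm]
  rcases lt_or_ge y x with hyx | hyx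
  · have hr : ∀ k, ring m y k = ring m' y k := fun k =>
      Finset.sum_congr rfl fun j _ => by rw [hl y hyx]
    have hc : coin m y = coin m' y := by
      funext k; simp only [coin, hl y hyx]
    rw [joinAt, if_pos hyx, hc]
    congr 1
    ext k
    simp only [Set.mem_ofPred_eq, hr]
    refine and_congr_right fun hk => ?_
    have hyr : y < dz ω m x (ring m' y k) := hyx.trans_le (le_dz _)
    rw [hnext _ (ring_pos hm' y k).le hk hyr]
    simp [hyr]
  · obtain ⟨i, rfl⟩ := Int.le.dest hyx
    -- The site `x + i` belongs to the growing half-line exactly from `t_{i+1}` on, so the condition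
    -- `y < θ r` in `eastLeft` becomes the condition `T ≤ r` of the splicing.
    have hiff : ∀ r, 0 ≤ r → (x + i < dz ω m x r ↔ jumpTime ω m x (i + 1) ≤ (r : EReal)) := by
      intro r hr
      rw [← le_dz_iff hm hr, Nat.cast_succ, ← add_assoc]
      exact Iff.rfl
    have hT := (hiff s h0).1 hy
    rcases jumpTime_succ_cases (ω := ω) (x := x) hm i with h1 | ⟨K, h1, -, h3⟩
    · rw [h1] at hT
      exact absurd (top_le_iff.1 hT) (EReal.coe_ne_top s)
    · have hsp := hs i (by omega) K h1
      rw [h1] at hT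
      rw [updated_spliced hm' hsp (fun r => eta ω m r (x + i + 1) = false) h3
        (EReal.coe_le_coe_iff.1 hT), joinAt, if_neg (not_lt.2 hyx)]
      congr 1
      ext k
      refine and_congr_right fun hk => ?_
      have h4 := hiff _ (ring_pos hm' (x + i) k).le
      rw [h1, EReal.coe_le_coe_iff] at h4
      simp only [h4]
      refine and_congr_right fun h5 => ?_
      rw [hnext _ (ring_pos hm' (x + i) k).le hk (h4.2 h5)]


/-! ### Measurability of the graphical construction -/

theorem measurable_updated {α : Type*} [MeasurableSpace α] {v : α → Bool} {L : α → Set ℕ}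
    {c : α → ℕ → Bool} (hv : Measurable v) (hL : ∀ k, MeasurableSet {a | k ∈ L a})
    (hc : ∀ k, Measurable fun a => c a k) : Measurable fun a => updated (v a) (L a) (c a) := by
  classical
  unfold updated
  refine Measurable.ite ?_ (measurable_eval_nat (measurable_nat_sSup hL) hc) hv
  have : {a | (L a).Nonempty} = ⋃ k, {a | k ∈ L a} := by
    ext a; simp [Set.Nonempty]
  rw [this]
  exact .iUnion hL

theorem measurable_ring (y : ℤ) (k : ℕ) : Measurable fun m : Marks => ring m y k := by
  unfold ring; fun_prop

theorem measurable_coin (y : ℤ) (k : ℕ) : Measurable fun m : Marks => coin m y k := by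
  unfold coin; fun_prop

theorem measurableSet_eq_false {α : Type*} [MeasurableSpace α] {f : α → Bool} (hf : Measurable f) :
    MeasurableSet {a | f a = false} := hf (measurableSet_singleton false)

theorem measurable_frozen (n : ℕ) (y : ℤ) :
    Measurable fun p : Config × Marks × ℝ => frozen p.1 p.2.1 n y p.2.2 := by
  induction n generalizing y with
  | zero => unfold frozen; fun_prop
  | succ n ih =>
    have hr := measurable_ring
    have hc := measurable_coin
    simp only [frozen]
    refine measurable_updated (by fun_prop) (fun k => ?_) (fun k => by fun_prop)
    have h1 : MeasurableSet {p : Config × Marks × ℝ | ring p.2.1 y k ≤ p.2.2} :=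
      measurableSet_le (by fun_prop) (by fun_prop)
    refine h1.inter
      (measurableSet_eq_false ((ih (y + 1)).comp (measurable_fst.prodMk
        ((measurable_fst.comp measurable_snd).prodMk
          ((hr y k).comp (measurable_fst.comp measurable_snd))))))

theorem measurable_eta (y : ℤ) :
    Measurable fun p : Config × Marks × ℝ => eta p.1 p.2.1 p.2.2 y := by
  have hr := measurable_ring
  unfold eta
  refine measurable_eval_nat (f := fun n (p : Config × Marks × ℝ) => frozen p.1 p.2.1 n y p.2.2)
    (measurable_nat_sInf fun n => ?_) fun n => measurable_frozen n y
  have : {a : Config × Marks × ℝ | n ∈ {n : ℕ | ∀ k, a.2.2 < ring a.2.1 (y + n) k}} =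
      ⋂ k, {a | a.2.2 < ring a.2.1 (y + n) k} := by
    ext a; simp
  rw [this]
  exact .iInter fun k => measurableSet_lt (by fun_prop) (by fun_prop)

theorem measurable_jumpTime (x : ℤ) (i : ℕ) :
    Measurable fun p : Config × Marks => jumpTime p.1 p.2 x i := by
  induction i with
  | zero => exact measurable_const
  | succ i ih =>
    have hr := measurable_ring
    classical
    simp only [jumpTime, iInf_eq_if]
    refine Measurable.iInf fun k => ?_
    have hrk : Measurable fun p : Config × Marks => (ring p.2 (x + i) k : EReal) :=
      measurable_coe_real_ereal.comp (by fun_prop)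
    refine Measurable.ite ?_ hrk measurable_const
    exact (measurableSet_lt ih hrk).inter (measurableSet_eq_false
      ((measurable_eta (x + i + 1)).comp (measurable_fst.prodMk
        (measurable_snd.prodMk ((hr (x + i) k).comp measurable_snd)))))

/-- The path of a walker that starts from `x` and jumps by one to the right at the times `τ`. -/
noncomputable def jumpPath (x : ℤ) (τ : ℕ → EReal) (s : ℝ) : ℤ :=
  x + (sSup {n : ℕ | τ n ≤ (s : EReal)} : ℕ)

theorem measurable_jumpPath (x : ℤ) :
    Measurable fun p : (ℕ → EReal) × ℝ => jumpPath x p.1 p.2 := by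
  unfold jumpPath
  have h : Measurable fun p : (ℕ → EReal) × ℝ => sSup {n : ℕ | p.1 n ≤ (p.2 : EReal)} :=
    measurable_nat_sSup fun k => measurableSet_le (by fun_prop)
      (measurable_coe_real_ereal.comp measurable_snd)
  have h2 : Measurable fun n : ℕ => x + (n : ℤ) := measurable_of_countable _
  exact h2.comp h

theorem measurable_dz (x : ℤ) (s : ℝ) :
    Measurable fun p : Config × Marks => dz p.1 p.2 x s :=
  (measurable_jumpPath x).comp
    ((measurable_pi_lambda _ fun i => measurable_jumpTime x i).prodMk measurable_const)

theorem measurable_eastLeftAux (x : ℤ) (n : ℕ) (y : ℤ) :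
    Measurable fun p : (ℕ → EReal) × Config × Marks × ℝ =>
      eastLeftAux (jumpPath x p.1) p.2.1 p.2.2.1 n y p.2.2.2 := by
  induction n generalizing y with
  | zero => exact measurable_const
  | succ n ih =>
    have hr := measurable_ring
    have hc := measurable_coin
    have hp := measurable_jumpPath x
    have hlt : ∀ f : (ℕ → EReal) × Config × Marks × ℝ → ℝ, Measurable f →
        MeasurableSet {p : (ℕ → EReal) × Config × Marks × ℝ | y < jumpPath x p.1 (f p)} :=
      fun f hf => measurableSet_lt measurable_const (hp.comp (measurable_fst.prodMk hf))
    simp only [eastLeftAux]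
    refine Measurable.ite (hlt _ (by fun_prop)) ?_ measurable_const
    refine measurable_updated (by fun_prop) (fun k => ?_) (fun k => by fun_prop)
    have h1 : MeasurableSet {p : (ℕ → EReal) × Config × Marks × ℝ | ring p.2.2.1 y k ≤ p.2.2.2} :=
      measurableSet_le (by fun_prop) (by fun_prop)
    refine h1.inter ((hlt (fun p => ring p.2.2.1 y k) (by fun_prop)).inter
      (measurableSet_eq_false ?_))
    exact (ih (y + 1)).comp (f := fun p : (ℕ → EReal) × Config × Marks × ℝ =>
      (p.1, p.2.1, p.2.2.1, ring p.2.2.1 y k)) (by fun_prop)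

theorem measurable_eastLeft (x y : ℤ) :
    Measurable fun p : (ℕ → EReal) × Config × Marks × ℝ =>
      eastLeft (jumpPath x p.1) p.2.1 p.2.2.1 p.2.2.2 y := by
  have hp : Measurable fun p : (ℕ → EReal) × Config × Marks × ℝ => jumpPath x p.1 p.2.2.2 :=
    (measurable_jumpPath x).comp (f := fun p : (ℕ → EReal) × Config × Marks × ℝ => (p.1, p.2.2.2))
      (by fun_prop)
  have h2 : Measurable fun n : ℤ => (n - y).toNat := measurable_of_countable _
  exact measurable_eval_nat (h2.comp hp) fun n => measurable_eastLeftAux x n y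

/-! ### Almost sure properties of the marks -/

instance (q : I) : IsProbabilityMeasure (marksLaw q) := by unfold marksLaw; infer_instance

instance (q : I) : IsProbabilityMeasure (equilibriumZ q) := by unfold equilibriumZ; infer_instance

instance (q : I) (Λ : Set ℤ) : IsProbabilityMeasure (equilibrium q Λ) := by
  unfold equilibrium; infer_instance

theorem ring_ge {m : Marks} (h : ∀ i, 0 < (m i).1) (y : ℤ) {k j : ℕ} (hj : j ≤ k) :
    (m (y, j)).1 ≤ ring m y k :=
  Finset.single_le_sum (f := fun j => (m (y, j)).1) (fun j _ => (h _).le) (by simp; omega)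

/-- Along independent waiting times arbitrarily long ones occur: along the rings of one site this
makes the clock unbounded, along first rings to the right it yields quiet sites. Integer bounds keep
the family of events countable, and the `+ 1` makes the inequalities strict. -/
theorem ae_goodMarks (q : I) : ∀ᵐ m ∂marksLaw q, GoodMarks m := by
  have h1 : ∀ᵐ m ∂marksLaw q, ∀ i, 0 < (m i).1 := by
    rw [ae_all_iff]
    intro i
    have h1 : ∀ᵐ a ∂markLaw q, 0 < a.1 := Measure.quasiMeasurePreserving_fst.ae exp_pos
    exact (measurePreserving_eval_infinitePi (fun _ : ℤ × ℕ => markLaw q)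
      i).quasiMeasurePreserving.ae h1
  have h2 : ∀ᵐ m ∂marksLaw q, ∀ (y : ℤ) (M : ℕ), ∃ k : ℕ, m (y, k) ∈ {a | (M : ℝ) + 1 ≤ a.1} := by
    rw [ae_all_iff]
    intro y
    rw [ae_all_iff]
    intro M
    exact ae_exists_coord_mem (markLaw q) (fun k : ℕ => (y, k)) (fun a b h => (Prod.mk.inj h).2)
      (measurableSet_mark_ge _) (markLaw_ge_ne_zero q _)
  have h3 : ∀ᵐ m ∂marksLaw q, ∀ (y : ℤ) (M : ℕ), ∃ n : ℕ,
      m (y + n, 0) ∈ {a | (M : ℝ) + 1 ≤ a.1} := by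
    rw [ae_all_iff]
    intro y
    rw [ae_all_iff]
    intro M
    exact ae_exists_coord_mem (markLaw q) (fun n : ℕ => (y + n, 0))
      (fun a b h => by simpa using (Prod.mk.inj h).1)
      (measurableSet_mark_ge _) (markLaw_ge_ne_zero q _)
  filter_upwards [h1, h2, h3] with m h1 h2 h3
  refine ⟨h1, fun y M => ?_, fun y s => ?_⟩
  · obtain ⟨k, hk⟩ := h2 y ⌈M⌉₊
    change ((⌈M⌉₊ : ℕ) : ℝ) + 1 ≤ _ at hk
    have := ring_ge h1 y (le_refl k)
    have := Nat.le_ceil M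
    exact ⟨k, by linarith⟩
  · obtain ⟨n, hn⟩ := h3 y ⌈s⌉₊
    change ((⌈s⌉₊ : ℕ) : ℝ) + 1 ≤ _ at hn
    refine ⟨n, fun k => ?_⟩
    have := ring_ge h1 (y + n) (Nat.zero_le k)
    have := Nat.le_ceil s
    linarith

/-- With all marks but the `k`-th fixed, the ring time is a constant plus a variable without atoms.
This excludes a jump exactly at time `t`. -/
theorem ae_ring_ne (q : I) (t : ℝ) : ∀ᵐ m ∂marksLaw q, ∀ y k, ring m y k ≠ t := by
  classical
  simp_rw [ae_all_iff]
  intro y k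
  have hmp : MeasurePreserving (fun p : Marks × (ℝ × Bool) => Function.update p.1 (y, k) p.2)
    ((marksLaw q).prod (markLaw q)) (marksLaw q) := measurePreserving_update (markLaw q) (y, k)
  have hS : MeasurableSet {m : Marks | ¬ ring m y k ≠ t} := by
    simp only [ne_eq, not_not]
    exact measurableSet_eq_fun (measurable_ring y k) measurable_const
  rw [ae_iff, ← hmp.measure_preimage hS.nullMeasurableSet,
    Measure.prod_apply (hmp.measurable hS), lintegral_eq_zero_iff
      (measurable_measure_prodMk_left (hmp.measurable hS))]
  refine ae_of_all _ fun m => ?_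
  have hr : ∀ a, ring (Function.update m (y, k) a) y k =
      (∑ j ∈ Finset.range k, (m (y, j)).1) + a.1 := by
    intro a
    rw [ring, Finset.sum_range_succ, Function.update_self]
    congr 1
    refine Finset.sum_congr rfl fun j hj => ?_
    rw [Function.update_of_ne]
    have := (Finset.mem_range.1 hj).ne
    simpa using this
  have := nullSingletonClass_exp
  have h0 : ∀ᵐ a ∂markLaw q, a.1 ≠ t - ∑ j ∈ Finset.range k, (m (y, j)).1 :=
    Measure.quasiMeasurePreserving_fst.ae (Measure.ae_ne _ _)
  rw [ae_iff] at h0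
  refine Eq.trans (congrArg _ ?_) h0
  ext a
  simp only [Set.mem_preimage, Set.mem_ofPred_eq, hr, ne_eq, not_not]
  constructor <;> intro h <;> linarith


/-! ### Resampling a clock -/

open Classical in
/-- Replace the coin of the ring of index `k` at `z`. -/
noncomputable def setCoin (z : ℤ) (k : ℕ) (m : Marks) (b : Bool) : Marks :=
  Function.update m (z, k) ((m (z, k)).1, b)

open Classical in
/-- Replace the marks at `z` after index `k`. -/
noncomputable def setTail (z : ℤ) (k : ℕ) (m : Marks) (u : ℕ → ℝ × Bool) : Marks :=
  fun i => if i.1 = z ∧ k < i.2 then u (i.2 - (k + 1)) else m i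

/-- Replace the coin of the ring of index `k` at `z` by `b`, and what follows this ring by what
the clock `u` does after the same time. -/
noncomputable def resampleAt (z : ℤ) (k : ℕ) (m : Marks) (b : Bool) (u : ℕ → ℝ × Bool) : Marks :=
  setTail z k (setCoin z k m b) (after u (ring m z k))

theorem setCoin_of_ne {z : ℤ} {k : ℕ} {i : ℤ × ℕ} (h : i ≠ (z, k)) (m : Marks) (b : Bool) :
    setCoin z k m b i = m i := Function.update_of_ne h _ _

theorem setCoin_self (z : ℤ) (k : ℕ) (m : Marks) (b : Bool) :
    setCoin z k m b (z, k) = ((m (z, k)).1, b) := Function.update_self _ _ _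

theorem setCoin_fst (z : ℤ) (k : ℕ) (m : Marks) (b : Bool) (i : ℤ × ℕ) :
    (setCoin z k m b i).1 = (m i).1 := by
  by_cases h : i = (z, k)
  · rw [h, setCoin_self]
  · rw [setCoin_of_ne h]

theorem ring_setCoin (z : ℤ) (k : ℕ) (m : Marks) (b : Bool) (y : ℤ) (j : ℕ) :
    ring (setCoin z k m b) y j = ring m y j :=
  Finset.sum_congr rfl fun _ _ => setCoin_fst _ _ _ _ _

theorem measurable_setCoin (z : ℤ) (k : ℕ) :
    Measurable fun p : Marks × Bool => setCoin z k p.1 p.2 := by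
  refine measurable_pi_lambda _ fun i => ?_
  by_cases h : i = (z, k)
  · subst h; simp only [setCoin_self]; fun_prop
  · simp only [setCoin_of_ne h]; fun_prop

theorem measurable_setTail (z : ℤ) (k : ℕ) :
    Measurable fun p : Marks × (ℕ → ℝ × Bool) => setTail z k p.1 p.2 := by
  refine measurable_pi_lambda _ fun i => ?_
  unfold setTail
  split_ifs <;> fun_prop

theorem measurable_resampleAt (z : ℤ) (k : ℕ) :
    Measurable fun p : Marks × Bool × (ℕ → ℝ × Bool) => resampleAt z k p.1 p.2.1 p.2.2 := by
  have hr := measurable_ring z k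
  have h1 := measurable_setTail z k
  have h2 := measurable_setCoin z k
  have h3 := measurable_after
  refine h1.comp (f := fun p : Marks × Bool × (ℕ → ℝ × Bool) =>
    (setCoin z k p.1 p.2.1, after p.2.2 (ring p.1 z k))) (Measurable.prodMk ?_ ?_)
  · exact h2.comp (f := fun p : Marks × Bool × (ℕ → ℝ × Bool) => (p.1, p.2.1)) (by fun_prop)
  · exact h3.comp (f := fun p : Marks × Bool × (ℕ → ℝ × Bool) => (p.2.2, ring p.1 z k))
      (by fun_prop)

theorem measurePreserving_setCoin (q : I) (z : ℤ) (k : ℕ) :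
    MeasurePreserving (fun p : Marks × Bool => setCoin z k p.1 p.2)
      ((marksLaw q).prod (siteLaw q)) (marksLaw q) := by
  classical
  have hupd : MeasurePreserving (fun p : Marks × (ℝ × Bool) => Function.update p.1 (z, k) p.2)
    ((marksLaw q).prod (markLaw q)) (marksLaw q) := measurePreserving_update (markLaw q) (z, k)
  have hab : MeasurePreserving (fun p : (ℝ × Bool) × Bool => (p.1.1, p.2))
      ((markLaw q).prod (siteLaw q)) (markLaw q) :=
    (measurePreserving_fst (μ := expMeasure 1) (ν := siteLaw q)).prod
      (MeasurePreserving.id (siteLaw q))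
  refine ⟨measurable_setCoin z k, ?_⟩
  have h1 := hupd.prod (MeasurePreserving.id (siteLaw q))
  have h2 := hupd.comp ((MeasurePreserving.id (marksLaw q)).prod hab)
  have h3 := measurePreserving_prodAssoc (marksLaw q) (markLaw q) (siteLaw q)
  have h4 := h2.comp h3
  rw [← h1.map_eq, Measure.map_map (measurable_setCoin z k) h1.measurable]
  refine Eq.trans ?_ h4.map_eq
  congr 1
  ext1 p
  simp only [Function.comp, Prod.map, id, MeasurableEquiv.prodAssoc, MeasurableEquiv.coe_mk,
    Equiv.prodAssoc_apply]
  unfold setCoin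
  rw [Function.update_self, Function.update_idem]

theorem measurePreserving_setTail (q : I) (z : ℤ) (k : ℕ) :
    MeasurePreserving (fun p : Marks × (ℕ → ℝ × Bool) => setTail z k p.1 p.2)
      ((marksLaw q).prod (clockLaw q)) (marksLaw q) := by
  have h : MeasurePreserving (mix {i : ℤ × ℕ | i.1 = z ∧ k < i.2}ᶜ (fun i => i.2 - (k + 1)))
      ((marksLaw q).prod (clockLaw q)) (marksLaw q) :=
    measurePreserving_mix (markLaw q) _ _ (by
      rw [compl_compl]
      rintro ⟨a, b⟩ ⟨h1, h2⟩ ⟨c, d⟩ ⟨h3, h4⟩ h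
      simp only at h1 h2 h3 h4 h
      rw [h1, h3]
      congr 1
      omega)
  convert h using 1
  funext p i
  simp only [setTail, mix, Set.mem_compl_iff, Set.mem_ofPred_eq]
  split_ifs <;> rfl

/-- The marks of a clock after a ring may be replaced by those of another clock after this time. -/
theorem measurePreserving_setTail_after (q : I) (z : ℤ) (k : ℕ) :
    MeasurePreserving (fun p : Marks × (ℕ → ℝ × Bool) => setTail z k p.1 (after p.2 (ring p.1 z k)))
      ((marksLaw q).prod (clockLaw q)) (marksLaw q) := by
  have hr := measurable_ring z k
  have h1 := measurePreserving_setTail q z k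
  have hm : Measurable (fun p : Marks × (ℕ → ℝ × Bool) =>
      setTail z k p.1 (after p.2 (ring p.1 z k))) :=
    h1.measurable.comp (f := fun p : Marks × (ℕ → ℝ × Bool) => (p.1, after p.2 (ring p.1 z k)))
      (measurable_fst.prodMk (measurable_after.comp
        (f := fun p : Marks × (ℕ → ℝ × Bool) => (p.2, ring p.1 z k)) (by fun_prop)))
  refine ⟨hm, ?_⟩
  ext A hA
  rw [Measure.map_apply hm hA, ← h1.measure_preimage hA.nullMeasurableSet,
    Measure.prod_apply (hm hA), Measure.prod_apply (h1.measurable hA)]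
  -- For fixed `m` the splicing time is a nonnegative constant, so `measurePreserving_after` applies
  -- in each fibre.
  refine lintegral_congr_ae ?_
  filter_upwards [ae_goodMarks q] with m hgood
  exact (measurePreserving_after q (ring_pos hgood z k).le).measure_preimage
    ((h1.measurable.comp measurable_prodMk_left) hA).nullMeasurableSet

theorem measurePreserving_resampleAt (q : I) (z : ℤ) (k : ℕ) :
    MeasurePreserving (fun p : Marks × Bool × (ℕ → ℝ × Bool) => resampleAt z k p.1 p.2.1 p.2.2)
      ((marksLaw q).prod ((siteLaw q).prod (clockLaw q))) (marksLaw q) := by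
  have h1 := (measurePreserving_setTail_after q z k).comp
    ((measurePreserving_setCoin q z k).prod (MeasurePreserving.id (clockLaw q)))
  have h2 := (measurePreserving_prodAssoc (marksLaw q) (siteLaw q) (clockLaw q)).symm
  convert h1.comp h2 using 1
  funext p
  simp only [resampleAt, Function.comp, Prod.map, id]
  rw [ring_setCoin]
  rfl

theorem measure_eq_tsum_inter {γ ι : Type*} [Countable ι] [MeasurableSpace γ] (ρ : Measure γ)
    (E : ι → Set γ) (hE : ∀ i, MeasurableSet (E i)) (hc : ∀ᵐ a ∂ρ, ∃ i, a ∈ E i)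
    (hd : ∀ᵐ a ∂ρ, ∀ i j, a ∈ E i → a ∈ E j → i = j) (B : Set γ) (hB : MeasurableSet B) :
    ρ B = ∑' i, ρ (B ∩ E i) := by
  rw [← measure_iUnion₀]
  · refine measure_congr ?_
    filter_upwards [hc] with a ⟨i, hi⟩
    refine propext ⟨fun h => Set.mem_iUnion.2 ⟨i, h, hi⟩, fun h => ?_⟩
    obtain ⟨j, h, -⟩ := Set.mem_iUnion.1 h
    exact h
  · intro i j hij
    refine measure_mono_null (t := {a | ¬ ∀ i j, a ∈ E i → a ∈ E j → i = j}) ?_ hd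
    rintro a ⟨⟨-, h1⟩, -, h2⟩ h
    exact hij (h i j h1 h2)
  · exact fun i => (hB.inter (hE i)).nullMeasurableSet

/-- A map that coincides on the pieces of a partition with measure preserving maps, each of which
leaves its piece invariant, is measure preserving. -/
theorem measurePreserving_of_partition {α β ι : Type*} [Countable ι] [MeasurableSpace α]
    [MeasurableSpace β] {μ : Measure α} {ν : Measure β} [SFinite μ] [IsProbabilityMeasure ν]
    {D : ι → Set α} (hD : ∀ i, MeasurableSet (D i)) (hcov : ∀ᵐ a ∂μ, ∃ i, a ∈ D i)
    (hdisj : ∀ᵐ a ∂μ, ∀ i j, a ∈ D i → a ∈ D j → i = j) {R : ι → α × β → α}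
    (hR : ∀ i, MeasurePreserving (R i) (μ.prod ν) μ) {F : α × β → α} (hF : Measurable F)
    (hFR : ∀ᵐ p ∂μ.prod ν, ∀ i, (p.1 ∈ D i → F p = R i p) ∧ (R i p ∈ D i ↔ p.1 ∈ D i)) :
    MeasurePreserving F (μ.prod ν) μ := by
  refine ⟨hF, ?_⟩
  ext A hA
  have hfst : Measure.QuasiMeasurePreserving (Prod.fst : α × β → α) (μ.prod ν) μ :=
    Measure.quasiMeasurePreserving_fst
  rw [Measure.map_apply hF hA, measure_eq_tsum_inter μ D hD hcov hdisj A hA,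
    measure_eq_tsum_inter (μ.prod ν) (fun i => Prod.fst ⁻¹' D i) (fun i => measurable_fst (hD i))
      (hfst.ae hcov)
      (hfst.ae hdisj) _ (hF hA)]
  refine tsum_congr fun i => ?_
  rw [← (hR i).measure_preimage (hA.inter (hD i)).nullMeasurableSet]
  refine measure_congr ?_
  filter_upwards [hFR] with p hp
  refine propext ⟨fun h => ?_, fun h => ?_⟩
  · exact ⟨by simpa [← (hp i).1 h.2] using h.1, (hp i).2.2 h.2⟩
  · have hi := (hp i).2.1 h.2
    exact ⟨by simpa [(hp i).1 hi] using h.1, hi⟩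

/-! ### Resampling the vacated sites -/

/-- The index of the ring of the site `x + n` at which the distinguished zero leaves this site. -/
noncomputable def jumpIndex (ω : Config) (x : ℤ) (n : ℕ) (m : Marks) : ℕ :=
  sInf {k | jumpTime ω m x (n + 1) = (ring m (x + n) k : EReal)}

open Classical in
/-- Resample the coin tossed at `x + n` when the distinguished zero leaves this site, and the marks
of this site from then on. -/
noncomputable def resampleSite (ω : Config) (x : ℤ) (n : ℕ) (m : Marks) (b : Bool)
    (u : ℕ → ℝ × Bool) : Marks :=
  if jumpTime ω m x (n + 1) = ⊤ then m else resampleAt (x + n) (jumpIndex ω x n m) m b u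

theorem measurableSet_jumpTime_eq_ring (ω : Config) (x : ℤ) (n k : ℕ) :
    MeasurableSet {m | jumpTime ω m x (n + 1) = (ring m (x + n) k : EReal)} :=
  measurableSet_eq_fun
    ((measurable_jumpTime x (n + 1)).comp (f := fun m : Marks => (ω, m)) (by fun_prop))
    (measurable_coe_real_ereal.comp (measurable_ring (x + n) k))

theorem measurableSet_jumpTime_eq_top (ω : Config) (x : ℤ) (n : ℕ) :
    MeasurableSet {m | jumpTime ω m x n = ⊤} :=
  ((measurable_jumpTime x n).comp (f := fun m : Marks => (ω, m)) (by fun_prop))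
    (measurableSet_singleton ⊤)

theorem measurable_resampleSite (ω : Config) (x : ℤ) (n : ℕ) :
    Measurable fun p : Marks × Bool × (ℕ → ℝ × Bool) => resampleSite ω x n p.1 p.2.1 p.2.2 := by
  unfold resampleSite
  refine Measurable.ite (measurable_fst (measurableSet_jumpTime_eq_top ω x (n + 1)))
    measurable_fst ?_
  exact measurable_eval_nat
    ((measurable_nat_sInf (measurableSet_jumpTime_eq_ring ω x n)).comp measurable_fst)
    fun k => measurable_resampleAt (x + n) k

theorem jumpIndex_eq {ω : Config} {x : ℤ} {n k : ℕ} {m : Marks} (hm : GoodMarks m)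
    (h : jumpTime ω m x (n + 1) = (ring m (x + n) k : EReal)) : jumpIndex ω x n m = k := by
  have : {j | jumpTime ω m x (n + 1) = (ring m (x + n) j : EReal)} = {k} := by
    ext j
    simp only [h, Set.mem_ofPred_eq, EReal.coe_eq_coe_iff, Set.mem_singleton_iff]
    rw [(ring_strictMono hm (x + n)).injective.eq_iff, eq_comm]
  rw [jumpIndex, this, csInf_singleton]

theorem resampleAt_of_ne {z : ℤ} {i : ℤ × ℕ} (h : i.1 ≠ z) (k : ℕ) (m : Marks) (b : Bool)
    (u : ℕ → ℝ × Bool) : resampleAt z k m b u i = m i := by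
  rw [resampleAt, setTail, if_neg (fun hi => h hi.1), setCoin_of_ne]
  rintro rfl
  exact h rfl

theorem resampleAt_of_lt {z : ℤ} {j k : ℕ} (h : j < k) (m : Marks) (b : Bool)
    (u : ℕ → ℝ × Bool) : resampleAt z k m b u (z, j) = m (z, j) := by
  rw [resampleAt, setTail, if_neg (fun hi => by have := hi.2; simp at this; omega), setCoin_of_ne]
  intro hi
  have := (Prod.mk.inj hi).2
  omega

theorem resampleAt_self (z : ℤ) (k : ℕ) (m : Marks) (b : Bool)
    (u : ℕ → ℝ × Bool) : resampleAt z k m b u (z, k) = ((m (z, k)).1, b) := by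
  rw [resampleAt, setTail, if_neg (fun hi => by have := hi.2; simp at this), setCoin_self]

theorem resampleAt_tail (z : ℤ) (k l : ℕ) (m : Marks) (b : Bool) (u : ℕ → ℝ × Bool) :
    resampleAt z k m b u (z, k + 1 + l) = after u (ring m z k) l := by
  rw [resampleAt, setTail, if_pos ⟨rfl, by simp; omega⟩]
  simp

theorem ring_resampleAt (z : ℤ) (k : ℕ) (m : Marks) (b : Bool) (u : ℕ → ℝ × Bool) :
    ring (resampleAt z k m b u) z k = ring m z k := by
  refine Finset.sum_congr rfl fun j hj => ?_
  rcases (Nat.lt_succ_iff.1 (Finset.mem_range.1 hj)).lt_or_eq with h | rfl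
  · rw [resampleAt_of_lt h]
  · rw [resampleAt_self]

/-- Changing at `x + n` only what follows the jump, and the coin of the jump, does not change the
trajectory. -/
theorem agreesBefore_of_jump {ω : Config} {x : ℤ} {n k : ℕ} {m m' : Marks} (hm : GoodMarks m)
    (hk : jumpTime ω m x (n + 1) = (ring m (x + n) k : EReal))
    (h1 : ∀ i : ℤ × ℕ, i.1 ≠ x + n → m' i = m i) (h2 : ∀ j < k, m' (x + n, j) = m (x + n, j))
    (h3 : (m' (x + n, k)).1 = (m (x + n, k)).1) : AgreesBefore x ω ω m m' where
  init _ _ := rfl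
  wait i j hj := by
    by_cases hi : i = n
    · subst hi
      rw [hk, EReal.coe_le_coe_iff, (ring_strictMono hm _).le_iff_le] at hj
      rcases hj.lt_or_eq with h | rfl
      · rw [h2 j h]
      · exact h3
    · rw [h1 _ (by simpa using hi)]
  toss i j hj := by
    by_cases hi : i = n
    · subst hi
      rw [hk, EReal.coe_lt_coe_iff, (ring_strictMono hm _).lt_iff_lt] at hj
      rw [coin, h2 j hj, coin]
    · rw [coin, h1 _ (by simpa using hi), coin]

theorem agreesBefore_resampleAt {ω : Config} {x : ℤ} {n k : ℕ} {m : Marks} (hm : GoodMarks m)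
    (hk : jumpTime ω m x (n + 1) = (ring m (x + n) k : EReal)) (b : Bool) (u : ℕ → ℝ × Bool) :
    AgreesBefore x ω ω m (resampleAt (x + n) k m b u) :=
  agreesBefore_of_jump hm hk (fun _ hi => resampleAt_of_ne hi _ _ _ _)
    (fun _ hj => resampleAt_of_lt hj _ _ _) (by rw [resampleAt_self])

/-- The ring index `k` of the jump is random, but for each fixed `k` the map `resampleAt` preserves
the law and, by `AgreesBefore`, neither creates nor destroys the event that the jump occurs at ring
`k`. The index `none` stands for no jump, where nothing is changed. -/
theorem measurePreserving_resampleSite (q : I) (ω : Config) (x : ℤ) (n : ℕ) :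
    MeasurePreserving (fun p : Marks × Bool × (ℕ → ℝ × Bool) =>
      resampleSite ω x n p.1 p.2.1 p.2.2)
      ((marksLaw q).prod ((siteLaw q).prod (clockLaw q))) (marksLaw q) := by
  set D : Option ℕ → Set Marks := fun o => o.elim {m | jumpTime ω m x (n + 1) = ⊤}
    fun k => {m | jumpTime ω m x (n + 1) = (ring m (x + n) k : EReal)} with hD
  set R : Option ℕ → Marks × Bool × (ℕ → ℝ × Bool) → Marks := fun o p => o.elim p.1
    fun k => resampleAt (x + n) k p.1 p.2.1 p.2.2 with hRdef
  have hR : ∀ o, MeasurePreserving (R o) ((marksLaw q).prod ((siteLaw q).prod (clockLaw q)))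
      (marksLaw q) := by
    rintro (_ | k)
    · exact measurePreserving_fst
    · exact measurePreserving_resampleAt q (x + n) k
  refine measurePreserving_of_partition (D := D) (R := R) ?_ ?_ ?_ hR
    (measurable_resampleSite ω x n) ?_
  · rintro (_ | k)
    · exact measurableSet_jumpTime_eq_top ω x (n + 1)
    · exact measurableSet_jumpTime_eq_ring ω x n k
  · filter_upwards [ae_goodMarks q] with m hm
    rcases jumpTime_succ_cases (ω := ω) (x := x) hm n with h | ⟨k, h, -⟩
    · exact ⟨none, h⟩
    · exact ⟨some k, h⟩
  · filter_upwards [ae_goodMarks q] with m hm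
    rintro (_ | k) (_ | k') h h' <;> simp only [hD, Option.elim, Set.mem_ofPred_eq] at h h'
    · rfl
    · rw [h] at h'; exact absurd h'.symm (EReal.coe_ne_top _)
    · rw [h'] at h; exact absurd h.symm (EReal.coe_ne_top _)
    · rw [h, EReal.coe_eq_coe_iff, (ring_strictMono hm _).injective.eq_iff] at h'
      rw [h']
  · have hgood : ∀ᵐ p ∂(marksLaw q).prod ((siteLaw q).prod (clockLaw q)), ∀ o,
        GoodMarks (R o p) := by
      rw [ae_all_iff]
      exact fun o => (hR o).quasiMeasurePreserving.ae (ae_goodMarks q)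
    filter_upwards [hgood] with p hp
    have h0 : GoodMarks p.1 := hp none
    rintro (_ | k)
    · exact ⟨fun h => if_pos h, Iff.rfl⟩
    · have hk := hp (some k)
      simp only [hD, hRdef, Option.elim, Set.mem_ofPred_eq] at hk ⊢
      refine ⟨fun h => ?_, fun h => ?_, fun h => ?_⟩
      · rw [resampleSite, if_neg (by rw [h]; exact EReal.coe_ne_top _), jumpIndex_eq h0 h]
      -- The roles are exchanged: agreement is measured from the resampled marks, which are the ones
      -- known to jump at ring `k`.
      · have ha : AgreesBefore x ω ω (resampleAt (x + n) k p.1 p.2.1 p.2.2) p.1 :=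
          agreesBefore_of_jump hk h (fun _ hi => (resampleAt_of_ne hi _ _ _ _).symm)
            (fun _ hj => (resampleAt_of_lt hj _ _ _).symm) (by rw [resampleAt_self])
        rw [ha.jumpTime_eq hk h0, h, ring_resampleAt]
      · rw [(agreesBefore_resampleAt h0 h _ _).jumpTime_eq h0 hk, h, ring_resampleAt]


/-- The law of fresh states for the vacated sites and of fresh marks. -/
noncomputable def freshLaw (q : I) : Measure (Config × Marks) :=
  (equilibriumZ q).prod (marksLaw q)

instance (q : I) : IsProbabilityMeasure (freshLaw q) := by unfold freshLaw; infer_instance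

/-- Take the marks `p.2` at the sites to the left of `x`, and resample the sites `x, …, x + n - 1`
from the times at which the distinguished zero leaves them, using the coins `p.1` and the
marks `p.2`. -/
noncomputable def resample (ω : Config) (x : ℤ) : ℕ → Marks → Config × Marks → Marks
  | 0, m, p => mix {i : ℤ × ℕ | x ≤ i.1} id (m, p.2)
  | n + 1, m, p =>
      resampleSite ω x n (resample ω x n m p) (p.1 (x + n)) fun j => p.2 (x + n, j)

open Classical in
/-- Overwrite the state and the marks of the site `z`. -/
noncomputable def overwrite (z : ℤ) (w : (Config × Marks) × Bool × (ℕ → ℝ × Bool)) :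
    Config × Marks :=
  (Function.update w.1.1 z w.2.1, mix {i : ℤ × ℕ | i.1 ≠ z} (fun i => i.2) (w.1.2, w.2.2))

theorem measurePreserving_prodProdProdComm {α β γ δ : Type*} [MeasurableSpace α]
    [MeasurableSpace β] [MeasurableSpace γ] [MeasurableSpace δ] (μa : Measure α) (μb : Measure β)
    (μc : Measure γ) (μd : Measure δ) [SFinite μa] [SFinite μb] [SFinite μc] [SFinite μd] :
    MeasurePreserving (fun w : (α × β) × γ × δ => ((w.1.1, w.2.1), (w.1.2, w.2.2)))
      ((μa.prod μb).prod (μc.prod μd)) ((μa.prod μc).prod (μb.prod μd)) := by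
  have h1 := measurePreserving_prodAssoc μa μb (μc.prod μd)
  have h2 := (MeasurePreserving.id μa).prod (measurePreserving_prodAssoc μb μc μd).symm
  have h3 := (MeasurePreserving.id μa).prod
    ((Measure.measurePreserving_swap (μ := μb) (ν := μc)).prod (MeasurePreserving.id μd))
  have h4 := (MeasurePreserving.id μa).prod (measurePreserving_prodAssoc μc μb μd)
  have h5 := (measurePreserving_prodAssoc μa μc (μb.prod μd)).symm
  exact h5.comp (h4.comp (h3.comp (h2.comp h1)))

theorem measurePreserving_overwrite (q : I) (z : ℤ) :
    MeasurePreserving (overwrite z) ((freshLaw q).prod ((siteLaw q).prod (clockLaw q)))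
      (freshLaw q) := by
  classical
  have h1 : MeasurePreserving (fun p : Config × Bool => Function.update p.1 z p.2)
      ((equilibriumZ q).prod (siteLaw q)) (equilibriumZ q) :=
    measurePreserving_update (siteLaw q) z
  have h2 : MeasurePreserving (mix {i : ℤ × ℕ | i.1 ≠ z} (fun i => i.2))
      ((marksLaw q).prod (clockLaw q)) (marksLaw q) :=
    measurePreserving_mix (markLaw q) _ _ (by
      rintro ⟨a, b⟩ h1 ⟨c, d⟩ h2 h
      simp only [Set.mem_compl_iff, Set.mem_ofPred_eq, not_not] at h1 h2 h
      rw [h1, h2, h])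
  exact (h1.prod h2).comp
    (measurePreserving_prodProdProdComm (equilibriumZ q) (marksLaw q) (siteLaw q) (clockLaw q))

theorem overwrite_fst_of_ne {z y : ℤ} (h : y ≠ z) (w : (Config × Marks) × Bool × (ℕ → ℝ × Bool)) :
    (overwrite z w).1 y = w.1.1 y := Function.update_of_ne h _ _

theorem overwrite_fst_self (z : ℤ) (w : (Config × Marks) × Bool × (ℕ → ℝ × Bool)) :
    (overwrite z w).1 z = w.2.1 := Function.update_self _ _ _

theorem overwrite_snd_of_ne {z y : ℤ} (h : y ≠ z) (k : ℕ)
    (w : (Config × Marks) × Bool × (ℕ → ℝ × Bool)) : (overwrite z w).2 (y, k) = w.1.2 (y, k) := by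
  simp [overwrite, mix, h]

theorem overwrite_snd_self (z : ℤ) (k : ℕ) (w : (Config × Marks) × Bool × (ℕ → ℝ × Bool)) :
    (overwrite z w).2 (z, k) = w.2.2 k := by
  simp [overwrite, mix]

/-- After `n` steps the fresh variables at `x + n` are still unused. They are therefore independent
of the current marks, which is what the next resampling needs. -/
theorem resample_congr (ω : Config) (x : ℤ) (n : ℕ) (m : Marks) {p p' : Config × Marks}
    (h1 : ∀ y < x + n, p.1 y = p'.1 y) (h2 : ∀ y < x + n, ∀ k, p.2 (y, k) = p'.2 (y, k)) :
    resample ω x n m p = resample ω x n m p' := by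
  induction n with
  | zero =>
    funext i
    by_cases hi : x ≤ i.1
    · simp [resample, mix, hi]
    · have := h2 i.1 (by push_cast; omega) i.2
      simp only [Prod.mk.eta] at this
      simp [resample, mix, hi, this]
  | succ n ih =>
    rw [resample, resample, ih (fun y hy => h1 y (by push_cast; omega))
      (fun y hy => h2 y (by push_cast; omega)), h1 (x + n) (by push_cast; omega)]
    congr 1
    funext k
    exact h2 (x + n) (by push_cast; omega) k

theorem measurable_resample (ω : Config) (x : ℤ) (n : ℕ) :
    Measurable fun w : Marks × Config × Marks => resample ω x n w.1 w.2 := by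
  induction n with
  | zero =>
    exact (measurable_mix _ _).comp (f := fun w : Marks × Config × Marks => (w.1, w.2.2))
      (by fun_prop)
  | succ n ih =>
    exact (measurable_resampleSite ω x n).comp (f := fun w : Marks × Config × Marks =>
      (resample ω x n w.1 w.2, w.2.1 (x + n), fun j => w.2.2 (x + n, j)))
      (ih.prodMk (by fun_prop))

/-- Resampling does not change the law of the marks. -/
theorem measurePreserving_resample (q : I) (ω : Config) (x : ℤ) (n : ℕ) :
    MeasurePreserving (fun w : Marks × Config × Marks => resample ω x n w.1 w.2)
      ((marksLaw q).prod (freshLaw q)) (marksLaw q) := by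
  induction n with
  | zero =>
    have h : MeasurePreserving (mix {i : ℤ × ℕ | x ≤ i.1} id)
        ((marksLaw q).prod (marksLaw q)) (marksLaw q) :=
      measurePreserving_mix (markLaw q) _ _ Function.injective_id.injOn
    exact h.comp ((MeasurePreserving.id (marksLaw q)).prod
      (measurePreserving_snd (μ := equilibriumZ q) (ν := marksLaw q)))
  | succ n ih =>
    refine ⟨measurable_resample ω x (n + 1), ?_⟩
    -- Overwriting the site `x + n` of the fresh variables by an independent copy keeps their law
    -- and makes the independence explicit.
    have h1 := (MeasurePreserving.id (marksLaw q)).prod (measurePreserving_overwrite q (x + n))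
    have h2 := (measurePreserving_resampleSite q ω x n).comp
      ((ih.prod (MeasurePreserving.id ((siteLaw q).prod (clockLaw q)))).comp
        (measurePreserving_prodAssoc (marksLaw q) (freshLaw q)
          ((siteLaw q).prod (clockLaw q))).symm)
    rw [← h1.map_eq, Measure.map_map (measurable_resample ω x (n + 1)) h1.measurable]
    refine Eq.trans ?_ h2.map_eq
    congr 1
    funext w
    simp only [Function.comp, Prod.map, id, resample, overwrite_fst_self, overwrite_snd_self]
    rw [resample_congr ω x n w.1 (p' := w.2.1) (fun y hy => overwrite_fst_of_ne hy.ne _)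
      (fun y hy k => overwrite_snd_of_ne hy.ne _ _)]
    rfl

/-- What resampling does to the trajectory of the distinguished zero and to the clocks. -/
theorem resample_spec {ω : Config} {x : ℤ} {m : Marks} {p : Config × Marks} (hm : GoodMarks m)
    (hg : ∀ n, GoodMarks (resample ω x n m p)) (n : ℕ) :
    (∀ i, jumpTime ω (resample ω x n m p) x i = jumpTime ω m x i) ∧
    (∀ y < x, ∀ k, resample ω x n m p (y, k) = p.2 (y, k)) ∧
    ∀ i < n, ∀ K, jumpTime ω (resample ω x n m p) x (i + 1) =
      (ring (resample ω x n m p) (x + i) K : EReal) →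
      Spliced (resample ω x n m p) p.2 p.1 (x + i) K := by
  induction n with
  | zero =>
    have hx : ∀ y, x ≤ y → ∀ k, resample ω x 0 m p (y, k) = m (y, k) := by
      intro y hy k; simp [resample, mix, hy]
    refine ⟨?_, fun y hy k => by simp [resample, mix, not_le.2 hy], fun i hi => by omega⟩
    have ha : AgreesBefore x ω ω m (resample ω x 0 m p) :=
      ⟨fun _ _ => rfl, fun i j _ => by rw [hx _ (by omega)],
        fun i j _ => by rw [coin, hx _ (by omega), coin]⟩
    exact ha.jumpTime_eq hm (hg 0)
  | succ n ih =>
    obtain ⟨ih1, ih2, ih3⟩ := ih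
    have hn := hg n
    have hn1 := hg (n + 1)
    rw [resample] at hn1 ⊢
    set m' := resample ω x n m p
    by_cases htop : jumpTime ω m' x (n + 1) = ⊤
    · rw [resampleSite, if_pos htop]
      refine ⟨ih1, ih2, fun i hi K hK => ?_⟩
      rcases (Nat.lt_succ_iff.1 hi).lt_or_eq with h | rfl
      · exact ih3 i h K hK
      · rw [htop] at hK
        exact absurd hK.symm (EReal.coe_ne_top _)
    · rcases jumpTime_succ_cases (ω := ω) (x := x) hn n with h | ⟨k, hk, -⟩
      · exact absurd h htop
      rw [resampleSite, if_neg htop, jumpIndex_eq hn hk] at hn1 ⊢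
      set b := p.1 (x + n)
      set u := fun j => p.2 (x + n, j)
      have hJ := (agreesBefore_resampleAt hn hk b u).jumpTime_eq hn hn1
      refine ⟨fun i => (hJ i).trans (ih1 i), fun y hy j => ?_, fun i hi K hK => ?_⟩
      · rw [resampleAt_of_ne (by simp only; omega), ih2 y hy]
      · rcases (Nat.lt_succ_iff.1 hi).lt_or_eq with h | rfl
        · have hne : ∀ j, resampleAt (x + n) k m' b u (x + i, j) = m' (x + i, j) := fun j =>
            resampleAt_of_ne (by simp only; omega) _ _ _ _
          have hr : ∀ j, ring (resampleAt (x + n) k m' b u) (x + i) j = ring m' (x + i) j :=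
            fun j => Finset.sum_congr rfl fun _ _ => by rw [hne]
          rw [hJ, hr] at hK
          obtain ⟨h1, h2⟩ := ih3 i h K hK
          refine ⟨?_, fun l => ?_⟩
          · rw [coin, hne]; exact h1
          · rw [hne, hr]; exact h2 l
        · have hKk : K = k := by
            rw [hJ, hk, ← ring_resampleAt (x + i) k m' b u, EReal.coe_eq_coe_iff] at hK
            exact ((ring_strictMono hn1 _).injective hK).symm
          subst hKk
          refine ⟨?_, fun l => ?_⟩
          · rw [coin, resampleAt_self]
          · rw [resampleAt_tail, ring_resampleAt]

/-! ### The law of the process to the left of the distinguished zero -/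

theorem measurable_leftPart_eta (x : ℤ) (t : ℝ) :
    Measurable fun p : Config × Marks => leftPart (dz p.1 p.2 x) (eta p.1 p.2) t := by
  refine measurable_pi_lambda _ fun s => measurable_pi_lambda _ fun y => ?_
  unfold leftPart
  refine Measurable.ite (measurableSet_lt measurable_const (measurable_dz x s)) ?_ measurable_const
  exact (measurable_eta y).comp (f := fun p : Config × Marks => (p.1, p.2, (s : ℝ))) (by fun_prop)

theorem measurable_joinAt (x : ℤ) (ω : Config) : Measurable (joinAt x ω) := by
  refine measurable_pi_lambda _ fun y => ?_
  unfold joinAt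
  split_ifs <;> fun_prop

theorem measurable_leftPart_eastLeft (x : ℤ) (ω : Config) (t : ℝ) :
    Measurable fun p : (ℕ → EReal) × Config × Marks => leftPart (jumpPath x p.1)
      (eastLeft (jumpPath x p.1) (joinAt x ω p.2.1) p.2.2) t := by
  refine measurable_pi_lambda _ fun s => measurable_pi_lambda _ fun y => ?_
  have hj := measurable_joinAt x ω
  unfold leftPart
  refine Measurable.ite (measurableSet_lt measurable_const ((measurable_jumpPath x).comp
    (measurable_fst.prodMk measurable_const))) ?_ measurable_const
  exact (measurable_eastLeft x y).comp (f := fun p : (ℕ → EReal) × Config × Marks =>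
    (p.1, joinAt x ω p.2.1, p.2.2, (s : ℝ))) (by fun_prop)

theorem measurable_jumpTimes (ω : Config) (x : ℤ) : Measurable fun m : Marks => jumpTime ω m x :=
  measurable_pi_lambda _ fun i =>
    (measurable_jumpTime x i).comp (f := fun m : Marks => (ω, m)) (by fun_prop)

theorem measurable_traj (x : ℤ) (t : ℝ) : Measurable fun (p : Config × Marks)
    (s : Set.Icc (0 : ℝ) t) => dz p.1 p.2 x s :=
  measurable_pi_lambda _ fun s => measurable_dz x s

/-- The joint law of the trajectory of the distinguished zero and of the process to its left. -/
theorem measure_leftPart_eta (q : I) {ω : Config} {x : ℤ} (hx : ω x = false) {t : ℝ}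
    {A : Set (Set.Icc (0 : ℝ) t → Config)} (hA : MeasurableSet A)
    {E : Set (Set.Icc (0 : ℝ) t → ℤ)} (hE : MeasurableSet E) :
    marksLaw q {m | (fun s : Set.Icc (0 : ℝ) t => dz ω m x s) ∈ E ∧
        leftPart (dz ω m x) (eta ω m) t ∈ A} =
      ((marksLaw q).prod (freshLaw q)) {w | (fun s : Set.Icc (0 : ℝ) t => dz ω w.1 x s) ∈ E ∧
        leftPart (dz ω w.1 x) (eastLeft (dz ω w.1 x) (joinAt x ω w.2.1) w.2.2) t ∈ A} := by
  have hmdz : Measurable fun m : Marks => dz ω m x t :=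
    (measurable_dz x t).comp (f := fun m : Marks => (ω, m)) (by fun_prop)
  have hmE : MeasurableSet {m : Marks | (fun s : Set.Icc (0 : ℝ) t => dz ω m x s) ∈ E} :=
    ((measurable_traj x t).comp (f := fun m : Marks => (ω, m)) (by fun_prop)) hE
  have hmL : MeasurableSet {m : Marks | leftPart (dz ω m x) (eta ω m) t ∈ A} :=
    ((measurable_leftPart_eta x t).comp (f := fun m : Marks => (ω, m)) (by fun_prop)) hA
  have hmR : MeasurableSet {w : Marks × Config × Marks | leftPart (dz ω w.1 x)
      (eastLeft (dz ω w.1 x) (joinAt x ω w.2.1) w.2.2) t ∈ A} :=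
    ((measurable_leftPart_eastLeft x ω t).comp (f := fun w : Marks × Config × Marks =>
      (jumpTime ω w.1 x, w.2)) (((measurable_jumpTimes ω x).comp measurable_fst).prodMk
        measurable_snd)) hA
  have hmD : ∀ N : ℕ, MeasurableSet {m : Marks | dz ω m x t = x + N} := fun N =>
    hmdz (measurableSet_singleton _)
  -- Only the sites left before `t` need resampling, and their number is random. Cutting both sides
  -- by the final position `x + N` allows a fixed number `N` of resampled sites on each piece.
  refine (measure_eq_tsum_inter (marksLaw q) (fun N : ℕ => {m | dz ω m x t = x + N}) hmD
    (ae_of_all _ fun m => ⟨_, rfl⟩)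
    (ae_of_all _ fun m i j hi hj => by simpa using hi.symm.trans hj) _ (hmE.inter hmL)).trans
    (Eq.trans (tsum_congr fun N => ?_) (measure_eq_tsum_inter _
      (fun N : ℕ => {w : Marks × Config × Marks | dz ω w.1 x t = x + N})
      (fun N => measurable_fst (hmD N)) (ae_of_all _ fun m => ⟨_, rfl⟩)
      (ae_of_all _ fun m i j hi hj => by simpa using hi.symm.trans hj) _
      ((measurable_fst hmE).inter hmR)).symm)
  rw [← (measurePreserving_resample q ω x N).measure_preimage
    ((hmE.inter hmL).inter (hmD N)).nullMeasurableSet]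
  have hgood : ∀ᵐ w ∂(marksLaw q).prod (freshLaw q), ∀ n, GoodMarks (resample ω x n w.1 w.2) := by
    rw [ae_all_iff]
    exact fun n => (measurePreserving_resample q ω x n).quasiMeasurePreserving.ae (ae_goodMarks q)
  have hg1 : ∀ᵐ w ∂(marksLaw q).prod (freshLaw q), GoodMarks w.1 :=
    Measure.quasiMeasurePreserving_fst.ae (ae_goodMarks q)
  have hg2 : ∀ᵐ w ∂(marksLaw q).prod (freshLaw q), GoodMarks w.2.2 :=
    Measure.quasiMeasurePreserving_snd.ae (Measure.quasiMeasurePreserving_snd.ae (ae_goodMarks q))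
  refine measure_congr ?_
  filter_upwards [hgood, hg1, hg2] with w h1 h2 h3
  obtain ⟨hs1, hs2, hs3⟩ := resample_spec h2 h1 N
  have hdz : dz ω (resample ω x N w.1 w.2) x = dz ω w.1 x := by
    funext s; simp only [dz, hs1]
  have key : dz ω w.1 x t = x + N →
      leftPart (dz ω w.1 x) (eta ω (resample ω x N w.1 w.2)) t =
        leftPart (dz ω w.1 x) (eastLeft (dz ω w.1 x) (joinAt x ω w.2.1) w.2.2) t := by
    intro hN
    rw [← hdz] at hN ⊢
    funext s y
    unfold leftPart
    split_ifs with hy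
    · refine eta_eq_eastLeft (h1 N) h3 hx hs2 hs3 s.2.1 ?_ hy
      rw [← hN]
      exact dz_mono (h1 N) s.2.1 s.2.2
    · rfl
  refine propext ?_
  change (((fun s : Set.Icc (0 : ℝ) t => dz ω (resample ω x N w.1 w.2) x s) ∈ E ∧
    leftPart (dz ω (resample ω x N w.1 w.2) x) (eta ω (resample ω x N w.1 w.2)) t ∈ A) ∧
      dz ω (resample ω x N w.1 w.2) x t = x + N) ↔
    ((fun s : Set.Icc (0 : ℝ) t => dz ω w.1 x s) ∈ E ∧ leftPart (dz ω w.1 x)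
      (eastLeft (dz ω w.1 x) (joinAt x ω w.2.1) w.2.2) t ∈ A) ∧ dz ω w.1 x t = x + N
  rw [hdz]
  refine and_congr_left fun hN => and_congr_right fun _ => ?_
  rw [key hN]


/-! ### Conditional laws -/

/-- A conditional probability read off from a joint law. -/
theorem condExp_of_joint {Ω Ω' : Type*} {m m0 : MeasurableSpace Ω} [MeasurableSpace Ω']
    {μ : Measure Ω} {ν : Measure Ω'} [IsProbabilityMeasure μ] [IsProbabilityMeasure ν]
    (hm : m ≤ m0) {B : Set Ω} (hB : MeasurableSet B) {T : Set (Ω × Ω')} (hT : MeasurableSet T)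
    (h : ∀ s, MeasurableSet[m] s → μ (s ∩ B) = (μ.prod ν) (Prod.fst ⁻¹' s ∩ T))
    (hg : AEStronglyMeasurable[m] (fun a => ν.real (Prod.mk a ⁻¹' T)) μ) :
    μ⟦B | m⟧ =ᵐ[μ] fun a => ν.real (Prod.mk a ⁻¹' T) := by
  have hTm : Measurable fun a => ν (Prod.mk a ⁻¹' T) := measurable_measure_prodMk_left hT
  have hint : Integrable (fun a => ν.real (Prod.mk a ⁻¹' T)) μ := by
    refine Integrable.of_bound (C := 1) hTm.ennreal_toReal.aestronglyMeasurable (ae_of_all _ ?_)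
    intro a
    rw [Real.norm_of_nonneg measureReal_nonneg]
    exact measureReal_le_one
  refine (ae_eq_condExp_of_forall_setIntegral_eq hm ((integrable_const (1 : ℝ)).indicator hB)
    (fun s _ _ => hint.integrableOn) (fun s hs _ => ?_) hg).symm
  have hs0 := hm s hs
  rw [integral_indicator_const _ hB, smul_eq_mul, mul_one]
  unfold Measure.real
  rw [integral_toReal hTm.aemeasurable (ae_of_all _ fun a => measure_lt_top _ _),
    Measure.restrict_apply hB, Set.inter_comm, h s hs,
    Measure.prod_apply ((measurable_fst hs0).inter hT), ← lintegral_indicator hs0]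
  congr 1
  refine lintegral_congr fun a => ?_
  by_cases ha : a ∈ s
  · rw [Set.indicator_of_mem ha]
    congr 1
    ext b
    simp [ha]
  · rw [Set.indicator_of_notMem ha]
    symm
    convert measure_empty (μ := ν)
    ext b
    simp [ha]

/-! ### The jump times are a function of the trajectory -/

/-- The rational times of `[0, t]`, and `t`. -/
def sampleTimes (t : ℝ) : Set (Set.Icc (0 : ℝ) t) :=
  {s | (s : ℝ) ∈ insert t (Set.range ((↑) : ℚ → ℝ))}

theorem countable_sampleTimes (t : ℝ) : (sampleTimes t).Countable :=
  ((Set.countable_range _).insert t).preimage Subtype.val_injective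

open Classical in
/-- The first sample times at which a path on `[0, t]` has reached `x + n`, for `n : ℕ`. -/
noncomputable def hitTime (x : ℤ) {t : ℝ} (ξ : Set.Icc (0 : ℝ) t → ℤ) (n : ℕ) : EReal :=
  ⨅ s : sampleTimes t, if x + n ≤ ξ s then ((s : Set.Icc (0 : ℝ) t) : ℝ) else ⊤

theorem measurable_hitTime (x : ℤ) (t : ℝ) :
    Measurable (hitTime x : (Set.Icc (0 : ℝ) t → ℤ) → ℕ → EReal) := by
  have := (countable_sampleTimes t).to_subtype
  refine measurable_pi_lambda _ fun n => ?_
  unfold hitTime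
  refine Measurable.iInf fun s => Measurable.ite ?_ measurable_const measurable_const
  exact measurableSet_le measurable_const (measurable_pi_apply _)

/-- The trajectory is a nondecreasing right-continuous step path, so its values at the rational
times and at `t` determine it on `[0, t]`. The time `t` is sampled separately because no rational to
its right is available. -/
theorem jumpPath_hitTime {ω : Config} {m : Marks} (hm : GoodMarks m) (x : ℤ) {t s : ℝ}
    (h0 : 0 ≤ s) (hst : s ≤ t) :
    jumpPath x (hitTime x fun r : Set.Icc (0 : ℝ) t => dz ω m x r) s = dz ω m x s := by
  have h : ∀ n : ℕ, hitTime x (fun r : Set.Icc (0 : ℝ) t => dz ω m x r) n ≤ (s : EReal) ↔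
      jumpTime ω m x n ≤ (s : EReal) := by
    intro n
    constructor
    · refine le_trans (le_iInf fun r => ?_)
      split_ifs with hr
      · exact (le_dz_iff hm r.1.2.1).1 hr
      · exact le_top
    · intro hn
      have hle : ∀ r (hr : r ∈ Set.Icc (0 : ℝ) t), s ≤ r →
          (⟨r, hr⟩ : Set.Icc (0 : ℝ) t) ∈ sampleTimes t →
          hitTime x (fun r : Set.Icc (0 : ℝ) t => dz ω m x r) n ≤ (r : EReal) := by
        intro r hr hsr hmem
        refine (iInf_le _ ⟨⟨r, hr⟩, hmem⟩).trans ?_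
        rw [if_pos]
        exact (le_dz_iff hm hr.1).2 (hn.trans (EReal.coe_le_coe_iff.2 hsr))
      rcases hst.eq_or_lt with rfl | hlt
      · exact hle s ⟨h0, le_rfl⟩ le_rfl (Set.mem_insert _ _)
      · refine EReal.le_of_forall_lt_iff_le.1 fun r hr => ?_
        have hr' : s < min r t := lt_min (EReal.coe_lt_coe_iff.1 hr) hlt
        obtain ⟨c, hc1, hc2⟩ := exists_rat_btwn hr'
        refine (hle c ⟨h0.trans hc1.le, (hc2.trans_le (min_le_right _ _)).le⟩ hc1.le
          (Set.mem_insert_of_mem _ ⟨c, rfl⟩)).trans ?_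
        exact EReal.coe_le_coe_iff.2 (hc2.trans_le (min_le_left _ _)).le
  simp only [jumpPath, h]
  rfl

/-- The conditional law of the process to the left of the distinguished zero, given the trajectory
of the latter. -/
theorem condLaw_leftPart (q : I) {ω : Config} {x : ℤ} (hx : ω x = false) (t : ℝ)
    {A : Set (Set.Icc (0 : ℝ) t → Config)} (hA : MeasurableSet A) :
    (marksLaw q)⟦{m | leftPart (dz ω m x) (eta ω m) t ∈ A} | trajSigma (fun m => dz ω m x) t⟧
      =ᵐ[marksLaw q] fun m => (freshLaw q).real
        {p | leftPart (dz ω m x) (eastLeft (dz ω m x) (joinAt x ω p.1) p.2) t ∈ A} := by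
  have htraj : Measurable fun (m : Marks) (s : Set.Icc (0 : ℝ) t) => dz ω m x s :=
    (measurable_traj x t).comp (f := fun m : Marks => (ω, m)) (by fun_prop)
  -- The candidate is written as a function of the jump times: `eastLeft` evaluates the path at
  -- random ring times, and joint measurability is available for `jumpPath`.
  set F : (ℕ → EReal) → ℝ := fun τ => (freshLaw q).real
    {p | leftPart (jumpPath x τ) (eastLeft (jumpPath x τ) (joinAt x ω p.1) p.2) t ∈ A} with hF
  have hFm : Measurable F :=
    (measurable_measure_prodMk_left (measurable_leftPart_eastLeft x ω t hA)).ennreal_toReal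
  refine condExp_of_joint (ν := freshLaw q) (T := {w | leftPart (dz ω w.1 x)
      (eastLeft (dz ω w.1 x) (joinAt x ω w.2.1) w.2.2) t ∈ A}) htraj.comap_le
    (((measurable_leftPart_eta x t).comp (f := fun m : Marks => (ω, m)) (by fun_prop)) hA)
    (((measurable_leftPart_eastLeft x ω t).comp (f := fun w : Marks × Config × Marks =>
      (jumpTime ω w.1 x, w.2)) (((measurable_jumpTimes ω x).comp measurable_fst).prodMk
        measurable_snd)) hA) ?_ ?_
  · rintro s ⟨E, hE, rfl⟩
    exact measure_leftPart_eta q hx hA hE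
  · refine ⟨fun m => F (hitTime x fun s : Set.Icc (0 : ℝ) t => dz ω m x s), ?_, ?_⟩
    · exact Measurable.stronglyMeasurable
        ((hFm.comp (measurable_hitTime x t)).comp (comap_measurable _))
    · filter_upwards [ae_goodMarks q] with m hm
      unfold Measure.real
      simp only [hF, Measure.real]
      congr 1
      refine measure_congr ?_
      have hg : ∀ᵐ p ∂freshLaw q, GoodMarks p.2 :=
        Measure.quasiMeasurePreserving_snd.ae (ae_goodMarks q)
      filter_upwards [hg] with p hp
      refine propext ?_
      suffices h : leftPart (dz ω m x) (eastLeft (dz ω m x) (joinAt x ω p.1) p.2) t =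
          leftPart (jumpPath x (hitTime x fun s : Set.Icc (0 : ℝ) t => dz ω m x s))
            (eastLeft (jumpPath x (hitTime x fun s : Set.Icc (0 : ℝ) t => dz ω m x s))
              (joinAt x ω p.1) p.2) t by
        change _ ∈ A ↔ _ ∈ A
        simp only [h]
      funext s y
      have hJ : ∀ r, 0 ≤ r → r ≤ t → dz ω m x r =
          jumpPath x (hitTime x fun s : Set.Icc (0 : ℝ) t => dz ω m x s) r :=
        fun r h1 h2 => (jumpPath_hitTime hm x h1 h2).symm
      rw [leftPart, leftPart, hJ s s.2.1 s.2.2, eastLeft_congr hp hJ s.2.1 s.2.2]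

/-- Almost surely, the distinguished zero makes finitely many jumps before time `t`, and none at
time `t`. -/
theorem ae_jumps (q : I) (ω : Config) (x : ℤ) {t : ℝ} (ht : 0 < t) :
    ∀ᵐ m ∂marksLaw q, ∃ N : ℕ,
      (∀ i < N, jumpTime ω m x i < jumpTime ω m x (i + 1)) ∧
      jumpTime ω m x N < (t : EReal) ∧ (t : EReal) < jumpTime ω m x (N + 1) ∧
      ∀ i ≤ N, ∀ s : ℝ, s ≤ t → jumpTime ω m x i ≤ (s : EReal) →
        (s : EReal) < jumpTime ω m x (i + 1) → dz ω m x s = x + i := by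
  filter_upwards [ae_goodMarks q, ae_ring_ne q t] with m hm hne
  obtain ⟨N, h1, h2⟩ := exists_jumpTime_index (ω := ω) (x := x) hm ht.le
  refine ⟨N, fun i hi => ?_, ?_, h2, fun i _ s _ h3 h4 => dz_eq hm h3 h4⟩
  · exact jumpTime_lt_succ hm
      (((jumpTime_mono hm hi.le).trans h1).trans_lt (EReal.coe_lt_top t))
  · refine lt_of_le_of_ne h1 ?_
    rcases N with _ | N
    · rw [jumpTime]
      exact (EReal.coe_lt_coe_iff.2 ht).ne
    · rcases jumpTime_succ_cases (ω := ω) (x := x) hm N with h | ⟨k, h, -⟩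
      · rw [h]; exact (EReal.coe_ne_top t).symm
      · rw [h]; exact fun h => hne _ _ (EReal.coe_eq_coe_iff.1 h)


/-! ### Equilibrium to the left of the distinguished zero -/

theorem measurable_glue (a x : ℤ) : Measurable (glue a x) := by
  refine measurable_pi_lambda _ fun y => ?_
  unfold glue
  split_ifs <;> fun_prop

section initial

variable (q : I) (a x : ℤ) (ψl : Measure (Set.Iio a → Bool)) (ψr : Measure (Set.Ioi x → Bool))
  [IsProbabilityMeasure ψl] [IsProbabilityMeasure ψr]

instance : IsProbabilityMeasure (initialLaw q a x ψl ψr) :=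
  Measure.isProbabilityMeasure_map (measurable_glue a x).aemeasurable

/-- The initial law is invariant under resampling the state of a site of `{a, …, x - 1}`. -/
theorem measurePreserving_update_initialLaw {y : ℤ} (hy : y ∈ Set.Ico a x) :
    MeasurePreserving (fun p : Config × Bool => Function.update p.1 y p.2)
      ((initialLaw q a x ψl ψr).prod (siteLaw q)) (initialLaw q a x ψl ψr) := by
  have hglue : MeasurePreserving (glue a x) (ψl.prod ((equilibrium q (Set.Ico a x)).prod ψr))
      (initialLaw q a x ψl ψr) := ⟨measurable_glue a x, rfl⟩
  have hupd : MeasurePreserving (fun p : (Set.Ico a x → Bool) × Bool =>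
      Function.update p.1 ⟨y, hy⟩ p.2) ((equilibrium q (Set.Ico a x)).prod (siteLaw q))
      (equilibrium q (Set.Ico a x)) := measurePreserving_update (siteLaw q) _
  have h1 := measurePreserving_prodAssoc ψl ((equilibrium q (Set.Ico a x)).prod ψr) (siteLaw q)
  have h2 := measurePreserving_prodAssoc (equilibrium q (Set.Ico a x)) ψr (siteLaw q)
  have h3 := (MeasurePreserving.id (equilibrium q (Set.Ico a x))).prod
    (Measure.measurePreserving_swap (μ := ψr) (ν := siteLaw q))
  have h4 := (measurePreserving_prodAssoc (equilibrium q (Set.Ico a x)) (siteLaw q) ψr).symm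
  have h5 := hupd.prod (MeasurePreserving.id ψr)
  have h6 := hglue.comp (((MeasurePreserving.id ψl).prod (h5.comp (h4.comp (h3.comp h2)))).comp h1)
  have hm : Measurable fun p : Config × Bool => Function.update p.1 y p.2 := by
    refine measurable_pi_lambda _ fun z => ?_
    by_cases h : z = y
    · subst h; simpa using measurable_snd
    · simp only [Function.update_of_ne h]; fun_prop
  have h7 := hglue.prod (MeasurePreserving.id (siteLaw q))
  refine ⟨hm, ?_⟩
  rw [← h7.map_eq, Measure.map_map hm h7.measurable]
  refine Eq.trans ?_ h6.map_eq
  congr 1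
  funext p z
  have e : (glue a x ∘ (Prod.map id ((Prod.map (fun p : (Set.Ico a x → Bool) × Bool =>
      Function.update p.1 ⟨y, hy⟩ p.2) id) ∘ MeasurableEquiv.prodAssoc.symm ∘
      Prod.map id Prod.swap ∘ MeasurableEquiv.prodAssoc)) ∘ MeasurableEquiv.prodAssoc) p =
      glue a x (p.1.1, Function.update p.1.2.1 ⟨y, hy⟩ p.2, p.1.2.2) := rfl
  refine Eq.trans ?_ (congrFun e z).symm
  simp only [Function.comp, Prod.map, id]
  by_cases h : z = y
  · subst h
    rw [Function.update_self, glue, dif_neg (not_lt.2 hy.1), dif_neg (not_lt.2 hy.2.le),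
      dif_pos hy.2]
    exact (Function.update_self (f := p.1.2.1) (⟨z, hy⟩ : Set.Ico a x) p.2).symm
  · rw [Function.update_of_ne h]
    unfold glue
    split_ifs
    · rfl
    · rfl
    · exact (Function.update_of_ne (fun he => h (congrArg Subtype.val he)) _ _).symm
    · rfl

end initial

/-- The indices of the legal rings at `y` up to time `t`. -/
def legalRings (t : ℝ) (y : ℤ) (w : Config × Marks) : Set ℕ :=
  {k | ring w.2 y k ≤ t ∧ eta w.1 w.2 (ring w.2 y k) (y + 1) = false}

theorem eta_eq_updated {w : Config × Marks} (hw : GoodMarks w.2) (t : ℝ) (y : ℤ) :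
    eta w.1 w.2 t y = updated (w.1 y) (legalRings t y w) (coin w.2 y) := eta_eq hw _ _ _

theorem measurableSet_mem_legalRings (t : ℝ) (y : ℤ) (k : ℕ) :
    MeasurableSet {w | k ∈ legalRings t y w} := by
  have hr := measurable_ring y k
  have h1 : MeasurableSet {w : Config × Marks | ring w.2 y k ≤ t} :=
    measurableSet_le (by fun_prop) measurable_const
  exact h1.inter (measurableSet_eq_false ((measurable_eta (y + 1)).comp
    (f := fun w : Config × Marks => (w.1, w.2, ring w.2 y k)) (by fun_prop)))

/-- The event that the last legal ring at `y` up to time `t` has index `k`, or that there is none if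
`o = none`. -/
def lastLegal (t : ℝ) (y : ℤ) (o : Option ℕ) : Set (Config × Marks) :=
  o.elim {w | ∀ k, k ∉ legalRings t y w} fun k => {w | IsGreatest (legalRings t y w) k}

theorem measurableSet_lastLegal (t : ℝ) (y : ℤ) (o : Option ℕ) :
    MeasurableSet (lastLegal t y o) := by
  have h := measurableSet_mem_legalRings t y
  rcases o with _ | k
  · have : lastLegal t y none = ⋂ k, {w | k ∈ legalRings t y w}ᶜ := by
      ext w; simp [lastLegal]
    rw [this]
    exact .iInter fun k => (h k).compl
  · have : lastLegal t y (some k) =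
        {w | k ∈ legalRings t y w} ∩ ⋂ j, ⋂ (_ : k < j), {w | j ∈ legalRings t y w}ᶜ := by
      ext w
      simp only [lastLegal, Option.elim, IsGreatest, upperBounds, Set.mem_ofPred_eq,
        Set.mem_inter_iff, Set.mem_iInter, Set.mem_compl_iff]
      refine and_congr_right fun _ => forall_congr' fun j => ?_
      rw [← not_le]
      tauto
    rw [this]
    exact (h k).inter (.iInter fun j => .iInter fun _ => (h j).compl)

theorem exists_lastLegal {w : Config × Marks} (hw : GoodMarks w.2) (t : ℝ) (y : ℤ) :
    ∃ o, w ∈ lastLegal t y o := by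
  rcases (legalRings t y w).eq_empty_or_nonempty with h | h
  · exact ⟨none, fun k => by rw [h]; exact id⟩
  · obtain ⟨k, hk⟩ := exists_isGreatest h (bddAbove_of_ring_le hw fun k hk => hk.1)
    exact ⟨some k, hk⟩

theorem lastLegal_unique {w : Config × Marks} {t : ℝ} {y : ℤ} {o o' : Option ℕ}
    (h : w ∈ lastLegal t y o) (h' : w ∈ lastLegal t y o') : o = o' := by
  rcases o with _ | k <;> rcases o' with _ | k'
  · rfl
  · exact absurd h'.1 (h k')
  · exact absurd h.1 (h' k)
  · exact congrArg some (IsGreatest.unique h h')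

/-- The event that the trajectory of the distinguished zero lies in `E` and ends at `b`, and that
the states between `c` and `b` are given by `κ`. -/
def rightEvent (x : ℤ) (t : ℝ) (E : Set (Set.Icc (0 : ℝ) t → ℤ)) (b c : ℤ) (κ : Config) :
    Set (Config × Marks) :=
  {w | (fun s : Set.Icc (0 : ℝ) t => dz w.1 w.2 x s) ∈ E ∧ dz w.1 w.2 x t = b ∧
    ∀ y, c ≤ y → y < b → eta w.1 w.2 t y = κ y}

theorem measurableSet_rightEvent (x : ℤ) (t : ℝ) {E : Set (Set.Icc (0 : ℝ) t → ℤ)}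
    (hE : MeasurableSet E) (b c : ℤ) (κ : Config) : MeasurableSet (rightEvent x t E b c κ) := by
  have h3 : {w : Config × Marks | ∀ y, c ≤ y → y < b → eta w.1 w.2 t y = κ y} =
      ⋂ y, ⋂ (_ : c ≤ y), ⋂ (_ : y < b), {w | eta w.1 w.2 t y = κ y} := by
    ext w; simp
  have h4 : MeasurableSet {w : Config × Marks | ∀ y, c ≤ y → y < b → eta w.1 w.2 t y = κ y} := by
    rw [h3]
    exact .iInter fun y => .iInter fun _ => .iInter fun _ =>
      ((measurable_eta y).comp (f := fun w : Config × Marks => (w.1, w.2, t)) (by fun_prop))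
        (measurableSet_singleton (κ y))
  exact (measurable_traj x t hE).inter ((measurable_dz x t (measurableSet_singleton b)).inter h4)

theorem rightEvent_of_agrees {x : ℤ} {t : ℝ} {E : Set (Set.Icc (0 : ℝ) t → ℤ)} {b y : ℤ}
    {κ : Config} {w w' : Config × Marks} (hdz : dz w'.1 w'.2 x = dz w.1 w.2 x)
    (h1 : ∀ z, y + 1 ≤ z → w.1 z = w'.1 z) (h2 : ∀ z, y + 1 ≤ z → ∀ k, w.2 (z, k) = w'.2 (z, k))
    (h : w ∈ rightEvent x t E b (y + 1) κ) : w' ∈ rightEvent x t E b (y + 1) κ := by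
  refine ⟨by rw [hdz]; exact h.1, by rw [hdz]; exact h.2.1, fun z hz hzb => ?_⟩
  rw [← h.2.2 z hz hzb]
  exact (eta_congr (fun z' hz' => h1 z' (hz.trans hz')) (fun z' hz' => h2 z' (hz.trans hz')) t).symm

/-- Legality of the rings at `y` depends on the waiting times at `y` and on what lies to the right,
but not on the coins or the initial state of `y`. -/
theorem mem_legalRings_congr {t : ℝ} {y : ℤ} {w w' : Config × Marks}
    (h1 : ∀ z, y + 1 ≤ z → w.1 z = w'.1 z) (h2 : ∀ z, y + 1 ≤ z → ∀ k, w.2 (z, k) = w'.2 (z, k))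
    (hr : ∀ k, ring w'.2 y k = ring w.2 y k) : legalRings t y w' = legalRings t y w := by
  ext k
  simp only [legalRings, Set.mem_ofPred_eq, hr]
  rw [eta_congr h1 h2]

/-- If the distinguished zero has moved beyond `x + i`, the first ring that made it leave this site
is legal. -/
theorem exists_legalRing {x : ℤ} {t : ℝ} (ht : 0 ≤ t) {i : ℕ} {w : Config × Marks}
    (hw : GoodMarks w.2) (h : x + i < dz w.1 w.2 x t) : ∃ K ∈ legalRings t (x + i) w,
      jumpTime w.1 w.2 x (i + 1) = (ring w.2 (x + i) K : EReal) := by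
  have h1 : jumpTime w.1 w.2 x (i + 1) ≤ (t : EReal) := by
    rw [← le_dz_iff hw ht, Nat.cast_succ, ← add_assoc]
    exact h
  rcases jumpTime_succ_cases (ω := w.1) (x := x) hw i with h2 | ⟨K, h2, -, h3⟩
  · rw [h2] at h1
    exact absurd (top_le_iff.1 h1) (EReal.coe_ne_top t)
  · rw [h2] at h1
    exact ⟨K, ⟨EReal.coe_le_coe_iff.1 h1, h3⟩, h2⟩

/-- The coin of the last legal ring at `y` affects no state to the right of `y`. If the zero visited
`y`, it left at a legal ring, whose index is at most `k`, so this coin is not among those tossed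
before the jump; otherwise `y < x` and the trajectory ignores `y`. -/
theorem setCoin_mem {x : ℤ} {t : ℝ} (ht : 0 ≤ t) {E : Set (Set.Icc (0 : ℝ) t → ℤ)} {b y : ℤ}
    (hy : y < b) {κ : Config} {k : ℕ} {w : Config × Marks} {v : Bool} (hw : GoodMarks w.2)
    (hw' : GoodMarks (setCoin y k w.2 v))
    (h : w ∈ rightEvent x t E b (y + 1) κ ∩ lastLegal t y (some k)) :
    (w.1, setCoin y k w.2 v) ∈ rightEvent x t E b (y + 1) κ ∩ lastLegal t y (some k) := by
  have hne : ∀ z, z ≠ y → ∀ j, setCoin y k w.2 v (z, j) = w.2 (z, j) := fun z hz j =>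
    setCoin_of_ne (fun h => hz (Prod.mk.inj h).1) _ _
  have h2 : ∀ z, y + 1 ≤ z → ∀ j, w.2 (z, j) = setCoin y k w.2 v (z, j) := fun z hz j =>
    (hne z (by omega) j).symm
  have ha : AgreesBefore x w.1 w.1 w.2 (setCoin y k w.2 v) := by
    refine ⟨fun _ _ => rfl, fun i j _ => setCoin_fst _ _ _ _ _, fun i j hj => ?_⟩
    by_cases hi : x + i = y
    · obtain ⟨K, hK, hKt⟩ := exists_legalRing (x := x) (i := i) ht hw (by
        rw [h.1.2.1, hi]; exact hy)
      have hKk : K ≤ k := by rw [hi] at hK; exact h.2.2 hK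
      rw [hKt, EReal.coe_lt_coe_iff, (ring_strictMono hw _).lt_iff_lt] at hj
      rw [coin, setCoin_of_ne, coin]
      intro h
      have := (Prod.mk.inj h).2
      omega
    · rw [coin, hne _ hi, coin]
  refine ⟨rightEvent_of_agrees (ha.dz_eq hw hw') (fun _ _ => rfl) h2 h.1, ?_⟩
  have hL : legalRings t y (w.1, setCoin y k w.2 v) = legalRings t y w :=
    mem_legalRings_congr (fun _ _ => rfl) h2 (ring_setCoin _ _ _ _ _)
  change IsGreatest _ _
  rw [hL]
  exact h.2

/-- For `y < x`, neither the trajectory nor the states to the right of `y` use the initial state of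
`y`. -/
theorem update_mem {x : ℤ} {t : ℝ} {E : Set (Set.Icc (0 : ℝ) t → ℤ)} {b y : ℤ} (hyx : y < x)
    {κ : Config} {w : Config × Marks} {v : Bool} (hw : GoodMarks w.2)
    (h : w ∈ rightEvent x t E b (y + 1) κ ∩ lastLegal t y none) :
    (Function.update w.1 y v, w.2) ∈ rightEvent x t E b (y + 1) κ ∩ lastLegal t y none := by
  have h1 : ∀ z, y + 1 ≤ z → w.1 z = Function.update w.1 y v z := fun z hz =>
    (Function.update_of_ne (by omega) _ _).symm
  have ha : AgreesBefore x w.1 (Function.update w.1 y v) w.2 w.2 :=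
    ⟨fun z hz => (h1 z (by omega)).symm, fun _ _ _ => rfl, fun _ _ _ => rfl⟩
  refine ⟨rightEvent_of_agrees (ha.dz_eq hw hw) h1 (fun _ _ _ => rfl) h.1, ?_⟩
  have hL : legalRings t y (Function.update w.1 y v, w.2) = legalRings t y w :=
    mem_legalRings_congr h1 (fun _ _ _ => rfl) (fun _ => rfl)
  change ∀ k, k ∉ _
  rw [hL]
  exact h.2

theorem ae_goodMarks_snd (q : I) (μ : Measure Config) :
    ∀ᵐ w ∂μ.prod (marksLaw q), GoodMarks w.2 :=
  Measure.quasiMeasurePreserving_snd.ae (ae_goodMarks q)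

/-- If an event is invariant under a measure preserving change of one Bernoulli variable, it is
independent of this variable. -/
theorem measure_inter_fresh {Ω S : Type*} [MeasurableSpace Ω] [MeasurableSpace S] {μ : Measure Ω}
    [SFinite μ] {ν : Measure S} [IsProbabilityMeasure ν] {ρ : Ω × S → Ω}
    (hρ : MeasurePreserving ρ (μ.prod ν) μ) {H : Set Ω} (hH : MeasurableSet H) {f : Ω → S}
    (hf : Measurable f) {V : Set S} (hV : MeasurableSet V)
    (h : ∀ᵐ p ∂μ.prod ν, (ρ p ∈ H ↔ p.1 ∈ H) ∧ (ρ p ∈ H → f (ρ p) = p.2)) :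
    μ (H ∩ f ⁻¹' V) = μ H * ν V := by
  rw [← hρ.measure_preimage (hH.inter (hf hV)).nullMeasurableSet, ← Measure.prod_prod]
  refine measure_congr ?_
  filter_upwards [h] with p hp
  refine propext ⟨fun h' => ⟨hp.1.1 h'.1, ?_⟩, fun h' => ⟨hp.1.2 h'.1, ?_⟩⟩
  · rw [← hp.2 h'.1]; exact h'.2
  · change f (ρ p) ∈ V
    rw [hp.2 (hp.1.2 h'.1)]; exact h'.2

section equilibrium

variable (q : I) (a x : ℤ) (ψl : Measure (Set.Iio a → Bool)) (ψr : Measure (Set.Ioi x → Bool))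
  [IsProbabilityMeasure ψl] [IsProbabilityMeasure ψr]

/-- The state of `y` at time `t` is independent of the trajectory of the distinguished zero and of
the states of the sites between `y` and the distinguished zero. -/
theorem measure_rightEvent_inter {t : ℝ} (ht : 0 ≤ t) {E : Set (Set.Icc (0 : ℝ) t → ℤ)}
    (hE : MeasurableSet E) {b y : ℤ} (hya : a ≤ y) (hyb : y < b) (κ : Config) (v : Bool) :
    ((initialLaw q a x ψl ψr).prod (marksLaw q))
        (rightEvent x t E b (y + 1) κ ∩ {w | eta w.1 w.2 t y = v}) =
      ((initialLaw q a x ψl ψr).prod (marksLaw q)) (rightEvent x t E b (y + 1) κ) *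
        siteLaw q {v} := by
  set Λ := (initialLaw q a x ψl ψr).prod (marksLaw q) with hΛ
  set F := rightEvent x t E b (y + 1) κ with hF
  have hFm : MeasurableSet F := measurableSet_rightEvent x t hE b (y + 1) κ
  have hη : Measurable fun w : Config × Marks => eta w.1 w.2 t y :=
    (measurable_eta y).comp (f := fun w : Config × Marks => (w.1, w.2, t)) (by fun_prop)
  have hV : MeasurableSet {w : Config × Marks | eta w.1 w.2 t y = v} :=
    hη (measurableSet_singleton v)
  have hgood := ae_goodMarks_snd q (initialLaw q a x ψl ψr)
  have hc : ∀ᵐ w ∂Λ, ∃ o, w ∈ lastLegal t y o := by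
    filter_upwards [hgood] with w hw using exists_lastLegal hw t y
  have hd : ∀ᵐ w ∂Λ, ∀ o o', w ∈ lastLegal t y o → w ∈ lastLegal t y o' → o = o' :=
    ae_of_all _ fun w o o' => lastLegal_unique
  rw [measure_eq_tsum_inter Λ (lastLegal t y) (measurableSet_lastLegal t y) hc hd _ (hFm.inter hV),
    measure_eq_tsum_inter Λ (lastLegal t y) (measurableSet_lastLegal t y) hc hd F hFm,
    ← ENNReal.tsum_mul_right]
  refine tsum_congr fun o => ?_
  rw [Set.inter_right_comm]
  have hHm := hFm.inter (measurableSet_lastLegal t y o)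
  have hg1 : ∀ᵐ p ∂Λ.prod (siteLaw q), GoodMarks p.1.2 :=
    Measure.quasiMeasurePreserving_fst.ae hgood
  rcases o with _ | k
  · rcases lt_or_ge y x with hyx | hyx
    · have hρ : MeasurePreserving
          (fun p : (Config × Marks) × Bool => (Function.update p.1.1 y p.2, p.1.2))
          (Λ.prod (siteLaw q)) Λ := by
        have h1 := (measurePreserving_update_initialLaw q a x ψl ψr ⟨hya, hyx⟩).prod
          (MeasurePreserving.id (marksLaw q))
        have h2 := (measurePreserving_prodAssoc (initialLaw q a x ψl ψr) (siteLaw q)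
          (marksLaw q)).symm
        have h3 := (MeasurePreserving.id (initialLaw q a x ψl ψr)).prod
          (Measure.measurePreserving_swap (μ := marksLaw q) (ν := siteLaw q))
        have h4 := measurePreserving_prodAssoc (initialLaw q a x ψl ψr) (marksLaw q) (siteLaw q)
        exact h1.comp (h2.comp (h3.comp h4))
      refine measure_inter_fresh hρ hHm hη (measurableSet_singleton v) ?_
      filter_upwards [hg1] with p hp
      refine ⟨⟨fun h => ?_, fun h => update_mem hyx hp h⟩, fun h => ?_⟩
      · have := update_mem (w := (Function.update p.1.1 y p.2, p.1.2)) (v := p.1.1 y) hyx hp h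
        simpa using this
      · rw [eta_eq_updated (w := (Function.update p.1.1 y p.2, p.1.2)) hp, updated_empty _ h.2]
        simp
    -- At a site `y ≥ x` that the zero has passed, the jump away from `y` is a legal ring, so this
    -- piece is null.
    · have h0 : Λ (F ∩ lastLegal t y none) = 0 := by
        rw [measure_eq_zero_iff_ae_notMem]
        filter_upwards [hgood] with w hw h
        obtain ⟨i, rfl⟩ := Int.le.dest hyx
        obtain ⟨K, hK, -⟩ := exists_legalRing (x := x) (i := i) ht hw (by
          rw [h.1.2.1]; exact hyb)
        exact h.2 K hK
      rw [measure_mono_null Set.inter_subset_left h0, h0, zero_mul]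
  · have hρ : MeasurePreserving (fun p : (Config × Marks) × Bool => (p.1.1, setCoin y k p.1.2 p.2))
        (Λ.prod (siteLaw q)) Λ := by
      have h1 := (MeasurePreserving.id (initialLaw q a x ψl ψr)).prod
        (measurePreserving_setCoin q y k)
      have h4 := measurePreserving_prodAssoc (initialLaw q a x ψl ψr) (marksLaw q) (siteLaw q)
      exact h1.comp h4
    have hg2 := hρ.quasiMeasurePreserving.ae hgood
    refine measure_inter_fresh hρ hHm hη (measurableSet_singleton v) ?_
    filter_upwards [hg1, hg2] with p hp hp'
    refine ⟨⟨fun h => ?_, fun h => setCoin_mem ht hyb hp hp' h⟩, fun h => ?_⟩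
    -- Restoring the old coin is another instance of `setCoin`, so invariance in one direction gives
    -- the equivalence.
    · have hback : setCoin y k (setCoin y k p.1.2 p.2) (p.1.2 (y, k)).2 = p.1.2 := by
        funext i
        by_cases hi : i = (y, k)
        · rw [hi, setCoin_self, setCoin_self]
        · rw [setCoin_of_ne hi, setCoin_of_ne hi]
      have := setCoin_mem (v := (p.1.2 (y, k)).2) ht hyb hp' (by
        change GoodMarks (setCoin y k (setCoin y k p.1.2 p.2) _); rw [hback]; exact hp) h
      change (p.1.1, setCoin y k (setCoin y k p.1.2 p.2) _) ∈ _ at this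
      rwa [hback] at this
    · rw [eta_eq_updated (w := (p.1.1, setCoin y k p.1.2 p.2)) hp', updated_of_isGreatest _ h.2]
      change (setCoin y k p.1.2 p.2 (y, k)).2 = p.2
      rw [setCoin_self]

theorem measure_rightEvent {t : ℝ} (ht : 0 ≤ t) {E : Set (Set.Icc (0 : ℝ) t → ℤ)}
    (hE : MeasurableSet E) (b : ℤ) (κ : Config) (n : ℕ) (hn : a ≤ b - n) :
    ((initialLaw q a x ψl ψr).prod (marksLaw q)) (rightEvent x t E b (b - n) κ) =
      ((initialLaw q a x ψl ψr).prod (marksLaw q)) (rightEvent x t E b b κ) *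
        ∏ y ∈ Finset.Ico (b - n) b, siteLaw q {κ y} := by
  induction n with
  | zero => simp
  | succ n ih =>
    push_cast at hn ⊢
    have h1 : rightEvent x t E b (b - (n + 1)) κ =
        rightEvent x t E b (b - (n + 1) + 1) κ ∩
          {w | eta w.1 w.2 t (b - (n + 1)) = κ (b - (n + 1))} := by
      ext w
      constructor
      · rintro ⟨h1, h2, h3⟩
        exact ⟨⟨h1, h2, fun y hy => h3 y (by omega)⟩, h3 _ le_rfl (by omega)⟩
      · rintro ⟨⟨h1, h2, h3⟩, h4⟩
        refine ⟨h1, h2, fun y hy hyb => ?_⟩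
        rcases hy.eq_or_lt with rfl | h
        · exact h4
        · exact h3 y (by omega) hyb
    rw [h1, measure_rightEvent_inter q a x ψl ψr ht hE hn (by omega),
      show b - ((n : ℤ) + 1) + 1 = b - n by ring, ih (by omega), mul_assoc]
    congr 1
    rw [show Finset.Ico (b - ((n : ℤ) + 1)) b = insert (b - ((n : ℤ) + 1)) (Finset.Ico (b - n) b) by
      ext y; simp only [Finset.mem_Ico, Finset.mem_insert]; omega, Finset.prod_insert (by
      simp only [Finset.mem_Ico]; omega), mul_comm]

/-- The joint law of the trajectory of the distinguished zero and of the configuration between `a`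
and the distinguished zero. -/
theorem measure_interval {t : ℝ} (ht : 0 ≤ t) {E : Set (Set.Icc (0 : ℝ) t → ℤ)}
    (hE : MeasurableSet E) {b : ℤ} (hab : a ≤ b) (S : Set (Set.Ico a b → Bool)) :
    ((initialLaw q a x ψl ψr).prod (marksLaw q))
        {w | ((fun s : Set.Icc (0 : ℝ) t => dz w.1 w.2 x s) ∈ E ∧ dz w.1 w.2 x t = b) ∧
          (fun y : Set.Ico a b => eta w.1 w.2 t y) ∈ S} =
      ((initialLaw q a x ψl ψr).prod (marksLaw q))
        {w | (fun s : Set.Icc (0 : ℝ) t => dz w.1 w.2 x s) ∈ E ∧ dz w.1 w.2 x t = b} *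
        equilibrium q (Set.Ico a b) S := by
  set Λ := (initialLaw q a x ψl ψr).prod (marksLaw q) with hΛ
  set F := {w : Config × Marks | (fun s : Set.Icc (0 : ℝ) t => dz w.1 w.2 x s) ∈ E ∧
    dz w.1 w.2 x t = b} with hF
  have hFm : MeasurableSet F :=
    (measurable_traj x t hE).inter (measurable_dz x t (measurableSet_singleton b))
  have hr : Measurable fun (w : Config × Marks) (y : Set.Ico a b) => eta w.1 w.2 t y :=
    measurable_pi_lambda _ fun y =>
      (measurable_eta y).comp (f := fun w : Config × Marks => (w.1, w.2, t)) (by fun_prop)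
  have hm : (Λ.restrict F).map (fun (w : Config × Marks) (y : Set.Ico a b) => eta w.1 w.2 t y) =
      Λ F • equilibrium q (Set.Ico a b) := by
    -- The configurations on `{a, …, b - 1}` form a finite space, so it suffices to prescribe all
    -- states; `κ` extends `τ` arbitrarily outside the interval.
    refine Measure.ext_of_singleton fun τ => ?_
    rw [Measure.map_apply hr (measurableSet_singleton τ),
      Measure.restrict_apply (hr (measurableSet_singleton τ)), Measure.smul_apply, smul_eq_mul,
      equilibrium, Measure.infinitePi_singleton_of_fintype]
    set κ : Config := fun y => if hy : y ∈ Set.Ico a b then τ ⟨y, hy⟩ else false with hκ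
    have h1 := measure_rightEvent q a x ψl ψr ht hE b κ (b - a).toNat (by omega)
    rw [show b - ((b - a).toNat : ℤ) = a by omega] at h1
    have h2 : rightEvent x t E b b κ = F := by
      ext w
      exact ⟨fun h => ⟨h.1, h.2.1⟩, fun h => ⟨h.1, h.2, fun y h1 h2 => absurd h1 (not_le.2 h2)⟩⟩
    have h3 : (fun (w : Config × Marks) (y : Set.Ico a b) => eta w.1 w.2 t y) ⁻¹' {τ} ∩ F =
        rightEvent x t E b a κ := by
      ext w
      simp only [Set.mem_inter_iff, Set.mem_preimage, Set.mem_singleton_iff]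
      constructor
      · rintro ⟨h, h1, h2⟩
        refine ⟨h1, h2, fun y hy hyb => ?_⟩
        have hy' : y ∈ Set.Ico a b := ⟨hy, hyb⟩
        simp only [hκ, dif_pos hy', ← h]
      · rintro ⟨h1, h2, h3⟩
        refine ⟨?_, h1, h2⟩
        funext y
        rw [h3 y y.2.1 y.2.2]
        simp [hκ, y.2.1, y.2.2]
    rw [h3, h1, h2]
    congr 1
    rw [← Set.toFinset_Ico, ← Finset.prod_set_coe]
    refine Finset.prod_congr rfl fun y _ => ?_
    have : κ y = τ y := by simp [hκ, y.2.1, y.2.2]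
    rw [this]
  have hS : MeasurableSet S := (Set.toFinite S).measurableSet
  have h := congrArg (fun ν => ν S) hm
  simp only [Measure.map_apply hr hS, Measure.restrict_apply (hr hS), Measure.smul_apply,
    smul_eq_mul] at h
  rw [← h, Set.inter_comm]
  rfl

end equilibrium


/-- If, on each event `{e (f w) = b}`, the configuration between `a` and `b` is in equilibrium
independently of `f`, then it is so conditionally on `f`. -/
theorem condExp_equilibrium {W Z : Type*} [MeasurableSpace W] [MeasurableSpace Z] {Λ : Measure W}
    [IsProbabilityMeasure Λ] {f : W → Z} (hf : Measurable f) {e : Z → ℤ} (he : Measurable e)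
    {η : W → Config} (hη : Measurable η) (q : I) (a : ℤ)
    (h : ∀ E, MeasurableSet E → ∀ (b : ℤ) (S : Set (Set.Ico a b → Bool)),
      Λ {w | (f w ∈ E ∧ e (f w) = b) ∧ (fun y : Set.Ico a b => η w y) ∈ S} =
        Λ {w | f w ∈ E ∧ e (f w) = b} * equilibrium q (Set.Ico a b) S)
    (B : (b : ℤ) → Set (Set.Ico a b → Bool)) :
    Λ⟦{w | (fun y : Set.Ico a (e (f w)) => η w y) ∈ B (e (f w))} |
        MeasurableSpace.comap f inferInstance⟧
      =ᵐ[Λ] fun w => (equilibrium q (Set.Ico a (e (f w)))).real (B (e (f w))) := by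
  have hBm : ∀ b, MeasurableSet (B b) := fun b => (Set.toFinite (B b)).measurableSet
  -- The law `μ_{a, …, b - 1}` lives on a space that depends on the random endpoint `b`. Realizing
  -- all of them as marginals of the single measure `equilibriumZ q` makes `condExp_of_joint`
  -- applicable.
  set C : ℤ → Set Config := fun b => {β | (fun y : Set.Ico a b => β y) ∈ B b} with hC
  have hCm : ∀ b, MeasurableSet (C b) := fun b =>
    (show Measurable fun (β : Config) (y : Set.Ico a b) => β y by fun_prop) (hBm b)
  have heq : ∀ b, equilibriumZ q (C b) = equilibrium q (Set.Ico a b) (B b) := by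
    intro b
    rw [equilibrium, ← Measure.infinitePi_map_restrict' (fun _ : ℤ => siteLaw q),
      Measure.map_apply (by fun_prop) (hBm b)]
    rfl
  have hD : ∀ b : ℤ, MeasurableSet {w | e (f w) = b} := fun b =>
    (he.comp hf) (measurableSet_singleton b)
  set T : Set (W × Config) := {p | p.2 ∈ C (e (f p.1))} with hT
  set G : Set W := {w | η w ∈ C (e (f w))} with hG
  have hTm : MeasurableSet T := by
    have : T = ⋃ b, {w | e (f w) = b} ×ˢ C b := by
      ext p; simp [hT]
    rw [this]
    exact .iUnion fun b => (hD b).prod (hCm b)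
  have hGm : MeasurableSet G := by
    have : G = ⋃ b, {w | e (f w) = b} ∩ η ⁻¹' C b := by
      ext p; simp [hG]
    rw [this]
    exact .iUnion fun b => (hD b).inter (hη (hCm b))
  have hreal : ∀ w, (equilibriumZ q).real (Prod.mk w ⁻¹' T) =
      (equilibrium q (Set.Ico a (e (f w)))).real (B (e (f w))) := fun w => by
    rw [Measure.real, Measure.real, ← heq]
    rfl
  have main := condExp_of_joint (μ := Λ) (ν := equilibriumZ q)
    (m := MeasurableSpace.comap f inferInstance) hf.comap_le hGm hTm ?_ ?_
  · simp only [hreal] at main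
    exact main
  · rintro s ⟨E, hE, rfl⟩
    have hEm := hf hE
    rw [measure_eq_tsum_inter Λ (fun b : ℤ => {w | e (f w) = b}) hD
        (ae_of_all _ fun w => ⟨_, rfl⟩) (ae_of_all _ fun w i j hi hj => hi.symm.trans hj) _
        (hEm.inter hGm),
      measure_eq_tsum_inter (Λ.prod (equilibriumZ q))
        (fun b : ℤ => Prod.fst ⁻¹' {w | e (f w) = b}) (fun b => measurable_fst (hD b))
        (ae_of_all _ fun w => ⟨_, rfl⟩) (ae_of_all _ fun w i j hi hj => hi.symm.trans hj) _
        ((measurable_fst hEm).inter hTm)]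
    refine tsum_congr fun b => ?_
    have h1 : f ⁻¹' E ∩ G ∩ {w | e (f w) = b} =
        {w | (f w ∈ E ∧ e (f w) = b) ∧ (fun y : Set.Ico a b => η w y) ∈ B b} := by
      ext w
      constructor
      · rintro ⟨⟨h1, h2⟩, rfl⟩
        exact ⟨⟨h1, rfl⟩, h2⟩
      · rintro ⟨⟨h1, rfl⟩, h2⟩
        exact ⟨⟨h1, h2⟩, rfl⟩
    have h2 : Prod.fst ⁻¹' (f ⁻¹' E) ∩ T ∩ Prod.fst ⁻¹' {w | e (f w) = b} =
        {w | f w ∈ E ∧ e (f w) = b} ×ˢ C b := by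
      ext p
      constructor
      · rintro ⟨⟨g1, g2⟩, g3⟩
        change e (f p.1) = b at g3
        subst g3
        exact ⟨⟨g1, rfl⟩, g2⟩
      · rintro ⟨⟨g1, g3⟩, g2⟩
        subst g3
        exact ⟨⟨g1, g2⟩, rfl⟩
    rw [h1, h2, Measure.prod_prod, heq, h E hE b (B b)]
  · refine ⟨fun w => (equilibriumZ q).real (Prod.mk w ⁻¹' T), ?_, Filter.EventuallyEq.rfl⟩
    simp only [hreal]
    have h1 : Measurable fun b : ℤ => (equilibrium q (Set.Ico a b)).real (B b) :=
      measurable_of_countable _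
    exact ((h1.comp he).comp (comap_measurable f)).stronglyMeasurable

/-- Given its trajectory, the configuration between `a` and the distinguished zero is in
equilibrium. -/
theorem condLaw_interval (q : I) {a x : ℤ} (hax : a ≤ x) (ψl : Measure (Set.Iio a → Bool))
    (ψr : Measure (Set.Ioi x → Bool)) [IsProbabilityMeasure ψl] [IsProbabilityMeasure ψr]
    {t : ℝ} (ht : 0 ≤ t) (B : (b : ℤ) → Set (Set.Ico a b → Bool)) :
    ((initialLaw q a x ψl ψr).prod (marksLaw q))⟦
        {w | (fun y : Set.Ico a (dz w.1 w.2 x t) => eta w.1 w.2 t y) ∈ B (dz w.1 w.2 x t)} |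
        trajSigma (fun w => dz w.1 w.2 x) t⟧
      =ᵐ[(initialLaw q a x ψl ψr).prod (marksLaw q)] fun w =>
        (equilibrium q (Set.Ico a (dz w.1 w.2 x t))).real (B (dz w.1 w.2 x t)) := by
  have hη : Measurable fun w : Config × Marks => eta w.1 w.2 t := measurable_pi_lambda _ fun y =>
    (measurable_eta y).comp (f := fun w : Config × Marks => (w.1, w.2, t)) (by fun_prop)
  refine condExp_equilibrium (Λ := (initialLaw q a x ψl ψr).prod (marksLaw q))
    (measurable_traj x t) (e := fun ξ => ξ ⟨t, ht, le_rfl⟩) (measurable_pi_apply _) hη q a ?_ B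
  intro E hE b S
  rcases lt_or_ge b a with hb | hb
  · have h0 : ∀ w : Config × Marks, dz w.1 w.2 x t ≠ b := fun w => by
      have := le_dz (ω := w.1) (m := w.2) (x := x) t
      omega
    simp [h0]
  · exact measure_interval q a x ψl ψr ht hE hb S

end East

theorem mainTheorem10 (q : I) (x : ℤ) :
    -- properties of the distinguished zero, for a fixed initial configuration with a zero at `x`
    (∀ ω : East.Config, ω x = false → ∀ t : ℝ, 0 < t →
      -- almost surely, `0 = t_0 < t_1 < ⋯ < t_N < t < t_{N+1}` for some `N`, and `ξ = x + i` on
      -- `[t_i, t_{i+1})`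
      (∀ᵐ m ∂(East.marksLaw q), ∃ N : ℕ,
        (∀ i < N, East.jumpTime ω m x i < East.jumpTime ω m x (i + 1)) ∧
        East.jumpTime ω m x N < (t : EReal) ∧
        (t : EReal) < East.jumpTime ω m x (N + 1) ∧
        ∀ i ≤ N, ∀ s : ℝ, s ≤ t → East.jumpTime ω m x i ≤ (s : EReal) →
          (s : EReal) < East.jumpTime ω m x (i + 1) → East.dz ω m x s = x + i) ∧
      -- the conditional law, given `(ξ_s)_{s ≤ t}`, of the process to the left of `ξ` up to time
      -- `t` is that of the East process with empty boundary at `ξ`, driven by fresh marks `p.2`,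
      -- in which each vacated site is put in a fresh Bernoulli state taken from `p.1`
      ∀ A : Set (Set.Icc (0 : ℝ) t → East.Config), MeasurableSet A →
        (East.marksLaw q)⟦{m | East.leftPart (East.dz ω m x) (East.eta ω m) t ∈ A} |
            East.trajSigma (fun m => East.dz ω m x) t⟧
          =ᵐ[East.marksLaw q] fun m =>
            ((East.equilibriumZ q).prod (East.marksLaw q)).real
              {p | East.leftPart (East.dz ω m x)
                (East.eastLeft (East.dz ω m x) (East.joinAt x ω p.1) p.2) t ∈ A}) ∧
    -- equilibrium zone
    (∀ a : ℤ, a ≤ x →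
      ∀ (ψl : Measure (Set.Iio a → Bool)) (ψr : Measure (Set.Ioi x → Bool)),
      IsProbabilityMeasure ψl → IsProbabilityMeasure ψr → ∀ t : ℝ, 0 ≤ t →
      ∀ B : (b : ℤ) → Set (Set.Ico a b → Bool),
        ((East.initialLaw q a x ψl ψr).prod (East.marksLaw q))⟦
            {w | (fun y : Set.Ico a (East.dz w.1 w.2 x t) => East.eta w.1 w.2 t y) ∈
              B (East.dz w.1 w.2 x t)} |
            East.trajSigma (fun w => East.dz w.1 w.2 x) t⟧
          =ᵐ[(East.initialLaw q a x ψl ψr).prod (East.marksLaw q)] fun w =>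
            (East.equilibrium q (Set.Ico a (East.dz w.1 w.2 x t))).real
              (B (East.dz w.1 w.2 x t))) :=
  ⟨fun ω hω t ht => ⟨East.ae_jumps q ω x ht, fun _ hA => East.condLaw_leftPart q hω t hA⟩,
    fun _ hax ψl ψr _ _ _ ht B => East.condLaw_interval q hax ψl ψr ht B⟩
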